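/- Let $n\ge 2$, $T>0$, $\tfrac12<s<1$, $0<\sigma<s$, $0<\lambda\le\Lambda$, $b\in\mathbb{R}^n$, $r\in\mathbb{R}$. Let $\psi:\mathbb{R}^n\to[0,\infty)$ belong to $C^2(\mathbb{R}^n)\cap W^{2,\infty}(\mathbb{R}^n)$. Write $\delta v(x,y)=v(x+y)+v(x-y)-2v(x)$, $a^\pm=\max\{\pm a,0\}$, and $$M^+v(x)=\int_{\mathbb{R}^n}\frac{\Lambda(\delta v(x,y))^+-\lambda(\delta v(x,y))^-}{|y|^{n+2\sigma}}\,dy,\qquad M^-v(x)=\int_{\mathbb{R}^n}\frac{\lambda(\delta v(x,y))^+-\Lambda(\delta v(x,y))^-}{|y|^{n+2\sigma}}\,dy .$$ Call $v:\mathbb{R}^n\to\mathbb{R}$ admissible at $x$ if it is measurable, $\int_{\mathbb{R}^n}\frac{|v(y)|}{1+|y|^{n+2\sigma}}\,dy<\infty$, and there are $\varepsilon>0$, $M>0$, $p\in\mathbb{R}^n$, with $p=0$ if $2\sigma+\varepsilon\le1$, such that $|v(x+y)-v(x)-p\cdot y|\le M|y|^{2\sigma+\varepsilon}$ for all small $y$.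 Let $\mathcal{I}$ be an operator such that $\mathcal{I}v(x)$ is defined whenever $v$ is admissible at $x$ and such that, for all such functions and points: $M^-(v-w)(x)\le\mathcal{I}v(x)-\mathcal{I}w(x)\le M^+(v-w)(x)$; $\mathcal{I}(v(\cdot+h))(x)=(\mathcal{I}v)(x+h)$; $\mathcal{I}(\theta v+(1-\theta)w)(x)\le\theta\,\mathcal{I}v(x)+(1-\theta)\,\mathcal{I}w(x)$ for $0\le\theta\le1$; and $\mathcal{I}(0)=0$. Let $(-\Delta)^s v(x)=-c_{n,s}\,\mathrm{P.V.}\!\int_{\mathbb{R}^n}\frac{v(y)-v(x)}{|y-x|^{n+2s}}\,dy$, where $c_{n,s}=\frac{4^s s\,\Gamma(n/2+s)}{\pi^{n/2}\Gamma(1-s)}$, and put $$\mathcal{L}v=\partial_tv+(-\Delta)^sv-b\cdot\nabla v-\mathcal{I}v-rv .$$ Let $u$ be a viscosity solution of $$\min\{\mathcal{L}u,\;u-\psi\}=0\ \text{ in }(0,T]\times\mathbb{R}^n,\qquad u(0,\cdot)=\psi\ \text{ in }\mathbb{R}^n,$$ that is, $u:[0,T]\times\mathbb{R}^n\to\mathbb{R}$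 is bounded and continuous, $u(0,\cdot)=\psi$, $u\ge\psi$, and for every $(t_0,x_0)\in(0,T]\times\mathbb{R}^n$, every $R>0$ and every $\phi\in C^{1,2}(\overline{B_R(t_0,x_0)})$ (once continuously differentiable in $t$ and twice in $x$) with $\phi(t_0,x_0)=u(t_0,x_0)$, the function $v$ equal to $\phi$ in $B_R(t_0,x_0)$ and to $u$ elsewhere satisfies - $\mathcal{L}v(t_0,x_0)\le0$, if $u(t_0,x_0)>\psi(x_0)$ and $u<\phi$ on $\big(B_R(t_0,x_0)\cap((0,T]\times\mathbb{R}^n)\big)\setminus\{(t_0,x_0)\}$; - $\mathcal{L}v(t_0,x_0)\ge0$, if $u>\phi$ on $\big(B_R(t_0,x_0)\cap((0,T]\times\mathbb{R}^n)\big)\setminus\{(t_0,x_0)\}$. Then there are constants $K,C\ge0$ such that for every $t\in(0,T]$ the function $u(t,\cdot)$ is Lipschitz on $\mathbb{R}^n$ with constant $K$, and $x\mapsto u(t,x)+\frac C2|x|^2$ is convex on $\mathbb{R}^n$. Moreover, for every $x\in\mathbb{R}^n$ the map $t\mapsto u(t,x)$ is nondecreasing on $[0,T]$. -/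

import Mathlib

open Real Set MeasureTheory

noncomputable section

/-- The Euclidean space `ℝⁿ`. -/
abbrev Rn (n : ℕ) : Type := EuclideanSpace ℝ (Fin n)

/-- The symmetric second difference `δ v(x, y) = v(x + y) + v(x - y) - 2 v(x)`. -/
def secondDiff {n : ℕ} (v : Rn n → ℝ) (x y : Rn n) : ℝ :=
  v (x + y) + v (x - y) - 2 * v x

/-- The normalising constant `c_{n,s} = 4ˢ s Γ(n/2 + s) / (π^{n/2} Γ(1 - s))` of the fractional
Laplacian of order `2 s`, `0 < s < 1`. -/
def fracConst (n : ℕ) (s : ℝ) : ℝ :=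
  (4 : ℝ) ^ s * s * Real.Gamma ((n : ℝ) / 2 + s) / (π ^ ((n : ℝ) / 2) * Real.Gamma (1 - s))

/-- The fractional Laplacian
`(-Δ)ˢ v(x) = - c_{n,s} P.V. ∫ (v(y) - v(x)) / |y - x|^{n+2s} dy`, with the principal value written
as the (absolutely convergent, for `v` bounded and `C²` near `x`) integral
`- (c_{n,s} / 2) ∫ δ v(x, y) / |y|^{n+2s} dy`. -/
def fracLaplacian {n : ℕ} (s : ℝ) (v : Rn n → ℝ) (x : Rn n) : ℝ :=
  -(fracConst n s / 2) * ∫ y : Rn n, secondDiff v x y / ‖y‖ ^ ((n : ℝ) + 2 * s)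

/-- The extremal operator `M⁺` of the class of linear operators `v ↦ ∫ δ v(x, y) K(y) dy` with
`K(y) = K(-y)` and `lam |y|^{-n-2σ} ≤ K(y) ≤ Lam |y|^{-n-2σ}`. -/
def extremalPlus {n : ℕ} (σ lam Lam : ℝ) (v : Rn n → ℝ) (x : Rn n) : ℝ :=
  ∫ y : Rn n, (Lam * max (secondDiff v x y) 0 - lam * max (-secondDiff v x y) 0)
    / ‖y‖ ^ ((n : ℝ) + 2 * σ)

/-- The extremal operator `M⁻` of the same class. -/
def extremalMinus {n : ℕ} (σ lam Lam : ℝ) (v : Rn n → ℝ) (x : Rn n) : ℝ :=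
  ∫ y : Rn n, (lam * max (secondDiff v x y) 0 - Lam * max (-secondDiff v x y) 0)
    / ‖y‖ ^ ((n : ℝ) + 2 * σ)

/-- `v` is punctually `C^{2σ+0⁺}` at `x`: for some `ε > 0`, near `y = 0`,
`|v(x+y) - v(x)| ≤ M |y|^{2σ+ε}` if `2σ + ε ≤ 1`, and
`|v(x+y) - v(x) - p·y| ≤ M |y|^{2σ+ε}` for some vector `p` if `2σ + ε > 1`. -/
def PunctuallyC {n : ℕ} (σ : ℝ) (v : Rn n → ℝ) (x : Rn n) : Prop :=
  ∃ ε > 0, ∃ p : Rn n, ∃ M > 0, ∃ ρ > 0, (2 * σ + ε ≤ 1 → p = 0) ∧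
    ∀ y : Rn n, ‖y‖ < ρ → |v (x + y) - v x - inner ℝ p y| ≤ M * ‖y‖ ^ (2 * σ + ε)

/-- The functions on which an operator of order `2σ` is evaluated at the point `x`: punctually
`C^{2σ+0⁺}` at `x`, with `∫ |v(y)| / (1 + |y|^{n+2σ}) dy < ∞`. -/
def AdmissibleAt {n : ℕ} (σ : ℝ) (v : Rn n → ℝ) (x : Rn n) : Prop :=
  PunctuallyC σ v x ∧ Integrable (fun y : Rn n => v y / (1 + ‖y‖ ^ ((n : ℝ) + 2 * σ)))

/-- `J` is a convex, translation-invariant operator with `J 0 = 0` that is uniformly elliptic with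
respect to the class of kernels between `lam |y|^{-n-2σ}` and `Lam |y|^{-n-2σ}`. Nothing is required
of the value `J v x` when `v` is not admissible at `x`. -/
structure IsConvexEllipticOperator {n : ℕ} (σ lam Lam : ℝ) (J : (Rn n → ℝ) → Rn n → ℝ) :
    Prop where
  elliptic : ∀ (v w : Rn n → ℝ) (x : Rn n), AdmissibleAt σ v x → AdmissibleAt σ w x →
    extremalMinus σ lam Lam (fun y => v y - w y) x ≤ J v x - J w x ∧
      J v x - J w x ≤ extremalPlus σ lam Lam (fun y => v y - w y) x
  translation : ∀ (v : Rn n → ℝ) (h x : Rn n), AdmissibleAt σ v (x + h) →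
    J (fun y => v (y + h)) x = J v (x + h)
  convex : ∀ (v w : Rn n → ℝ) (x : Rn n) (θ : ℝ), AdmissibleAt σ v x → AdmissibleAt σ w x →
    0 ≤ θ → θ ≤ 1 →
    J (fun y => θ * v y + (1 - θ) * w y) x ≤ θ * J v x + (1 - θ) * J w x
  zero : ∀ x : Rn n, J (fun _ => 0) x = 0

/-- The obstacle: nonnegative, of class `C²(ℝⁿ) ∩ W^{2,∞}(ℝⁿ)`. -/
structure IsObstacle {n : ℕ} (ψ : Rn n → ℝ) : Prop where
  nonneg : ∀ x, 0 ≤ ψ x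
  contDiff : ContDiff ℝ 2 ψ
  bounded : ∃ M : ℝ, ∀ x, |ψ x| ≤ M ∧ ‖fderiv ℝ ψ x‖ ≤ M ∧ ‖iteratedFDeriv ℝ 2 ψ x‖ ≤ M

/-- The (Euclidean) open ball of radius `R` about `(t₀, x₀)` in `ℝ × ℝⁿ`. -/
def stBall {n : ℕ} (t₀ : ℝ) (x₀ : Rn n) (R : ℝ) : Set (ℝ × Rn n) :=
  {p | (p.1 - t₀) ^ 2 + ‖p.2 - x₀‖ ^ 2 < R ^ 2}

/-- The (Euclidean) closed ball of radius `R` about `(t₀, x₀)` in `ℝ × ℝⁿ`. -/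
def stClosedBall {n : ℕ} (t₀ : ℝ) (x₀ : Rn n) (R : ℝ) : Set (ℝ × Rn n) :=
  {p | (p.1 - t₀) ^ 2 + ‖p.2 - x₀‖ ^ 2 ≤ R ^ 2}

/-- `φ` is of class `C^{1,2}` on the closed ball: `φ, ∂ₜφ, D_xφ, D_x²φ` exist in the open ball and
are continuous up to its boundary. -/
def IsC12OnBall {n : ℕ} (φ : ℝ → Rn n → ℝ) (t₀ : ℝ) (x₀ : Rn n) (R : ℝ) : Prop :=
  ∃ (φt : ℝ → Rn n → ℝ) (dφ : ℝ → Rn n → (Rn n →L[ℝ] ℝ))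
    (ddφ : ℝ → Rn n → (Rn n →L[ℝ] Rn n →L[ℝ] ℝ)),
    ContinuousOn (fun p : ℝ × Rn n => φ p.1 p.2) (stClosedBall t₀ x₀ R) ∧
    ContinuousOn (fun p : ℝ × Rn n => φt p.1 p.2) (stClosedBall t₀ x₀ R) ∧
    ContinuousOn (fun p : ℝ × Rn n => dφ p.1 p.2) (stClosedBall t₀ x₀ R) ∧
    ContinuousOn (fun p : ℝ × Rn n => ddφ p.1 p.2) (stClosedBall t₀ x₀ R) ∧
    ∀ t x, (t, x) ∈ stBall t₀ x₀ R →
      HasDerivAt (fun τ => φ τ x) (φt t x) t ∧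
      HasFDerivAt (φ t) (dφ t x) x ∧
      HasFDerivAt (dφ t) (ddφ t x) x

/-- `𝓛 v(t,x) = ∂ₜv + (-Δ)ˢ v - b·∇v - J v - r v` at `(t, x)`, the spatial operators acting on
`v(t, ·)`. -/
def parabolicOp {n : ℕ} (s : ℝ) (b : Rn n) (r : ℝ) (J : (Rn n → ℝ) → Rn n → ℝ)
    (v : ℝ → Rn n → ℝ) (t : ℝ) (x : Rn n) : ℝ :=
  deriv (fun τ => v τ x) t + fracLaplacian s (v t) x - fderiv ℝ (v t) x b - J (v t) x - r * v t x

open Classical in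
/-- The function equal to `φ` in the ball of radius `R` about `(t₀, x₀)` and to `u` elsewhere. -/
def glue {n : ℕ} (φ u : ℝ → Rn n → ℝ) (t₀ : ℝ) (x₀ : Rn n) (R : ℝ) : ℝ → Rn n → ℝ :=
  fun t x => if (t, x) ∈ stBall t₀ x₀ R then φ t x else u t x

/-- `𝓛 u ≤ 0` at `(t₀, x₀)` in the viscosity sense, for `u` on `(0, T] × ℝⁿ`. -/
def ViscositySubAt {n : ℕ} (T s : ℝ) (b : Rn n) (r : ℝ) (J : (Rn n → ℝ) → Rn n → ℝ)
    (u : ℝ → Rn n → ℝ) (t₀ : ℝ) (x₀ : Rn n) : Prop :=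
  ∀ (φ : ℝ → Rn n → ℝ) (R : ℝ), 0 < R → IsC12OnBall φ t₀ x₀ R →
    u t₀ x₀ - φ t₀ x₀ = 0 →
    (∀ t x, t ∈ Ioc 0 T → (t, x) ∈ stBall t₀ x₀ R → (t, x) ≠ (t₀, x₀) → u t x - φ t x < 0) →
    parabolicOp s b r J (glue φ u t₀ x₀ R) t₀ x₀ ≤ 0

/-- `𝓛 u ≥ 0` at `(t₀, x₀)` in the viscosity sense, for `u` on `(0, T] × ℝⁿ`. -/
def ViscositySuperAt {n : ℕ} (T s : ℝ) (b : Rn n) (r : ℝ) (J : (Rn n → ℝ) → Rn n → ℝ)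
    (u : ℝ → Rn n → ℝ) (t₀ : ℝ) (x₀ : Rn n) : Prop :=
  ∀ (φ : ℝ → Rn n → ℝ) (R : ℝ), 0 < R → IsC12OnBall φ t₀ x₀ R →
    u t₀ x₀ - φ t₀ x₀ = 0 →
    (∀ t x, t ∈ Ioc 0 T → (t, x) ∈ stBall t₀ x₀ R → (t, x) ≠ (t₀, x₀) → 0 < u t x - φ t x) →
    0 ≤ parabolicOp s b r J (glue φ u t₀ x₀ R) t₀ x₀

/-- Boundedness on `[0, T] × ℝⁿ`. -/
def BoundedOnStrip {n : ℕ} (T : ℝ) (u : ℝ → Rn n → ℝ) : Prop :=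
  ∃ M : ℝ, ∀ t ∈ Icc 0 T, ∀ x, |u t x| ≤ M

/-- Viscosity subsolutions of `min {𝓛 u, u - ψ} = 0` in `(0, T] × ℝⁿ`, `u(0, ·) = ψ`. Only the values
of `u` on `[0, T] × ℝⁿ` matter. -/
structure IsObstacleSubsolution {n : ℕ} (T s : ℝ) (b : Rn n) (r : ℝ)
    (J : (Rn n → ℝ) → Rn n → ℝ) (ψ : Rn n → ℝ) (u : ℝ → Rn n → ℝ) : Prop where
  usc : UpperSemicontinuousOn (fun p : ℝ × Rn n => u p.1 p.2) (Icc 0 T ×ˢ univ)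
  bounded : BoundedOnStrip T u
  viscosity : ∀ t ∈ Ioc 0 T, ∀ x, ψ x < u t x → ViscositySubAt T s b r J u t x
  initial : ∀ x, u 0 x ≤ ψ x

/-- Viscosity supersolutions of the same problem. -/
structure IsObstacleSupersolution {n : ℕ} (T s : ℝ) (b : Rn n) (r : ℝ)
    (J : (Rn n → ℝ) → Rn n → ℝ) (ψ : Rn n → ℝ) (u : ℝ → Rn n → ℝ) : Prop where
  lsc : LowerSemicontinuousOn (fun p : ℝ × Rn n => u p.1 p.2) (Icc 0 T ×ˢ univ)
  bounded : BoundedOnStrip T u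
  above : ∀ t ∈ Ioc 0 T, ∀ x, ψ x ≤ u t x
  viscosity : ∀ t ∈ Ioc 0 T, ∀ x, ViscositySuperAt T s b r J u t x
  initial : ∀ x, ψ x ≤ u 0 x

/-- Viscosity solutions of the obstacle problem: continuous on `[0, T] × ℝⁿ`, bounded, and both a
subsolution and a supersolution. -/
structure IsObstacleSolution {n : ℕ} (T s : ℝ) (b : Rn n) (r : ℝ)
    (J : (Rn n → ℝ) → Rn n → ℝ) (ψ : Rn n → ℝ) (u : ℝ → Rn n → ℝ) : Prop where
  continuous : ContinuousOn (fun p : ℝ × Rn n => u p.1 p.2) (Icc 0 T ×ˢ univ)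
  sub : IsObstacleSubsolution T s b r J ψ u
  super : IsObstacleSupersolution T s b r J ψ u

/-- `f` is `C`-semiconvex: `f + (C/2) |x|²` is convex. -/
def IsSemiconvexWith {n : ℕ} (C : ℝ) (f : Rn n → ℝ) : Prop :=
  ConvexOn ℝ univ (fun x => f x + C / 2 * ‖x‖ ^ 2)

end

open Filter Topology

/-! All three conclusions come from one comparison principle, `le_combination_translates`: if ψ lies
below θψ(·+h) + (1-θ)ψ(·+k) + c, then u(t,·) lies below the same combination of translates of
u(t+τ,·), with error c·exp(ρt), where ρ = max(r,0) + 1. Equal shifts h = k with τ = 0 turn the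
Lipschitz bound of ψ into one for u. Shifts from a convex combination to its two endpoints turn the
lower Hessian bound of ψ into semiconvexity. Taking h = k = 0, c = 0 and τ > 0 gives monotonicity in
time.

The comparison is proved by tripling the variables. If it fails, the excess of u over the
combination exceeds c·exp(ρt) somewhere. There u > ψ, because the translates lie above the obstacle,
and the time is positive, because u(0,·) = ψ. So the subsolution inequality holds at the upper point
and the supersolution inequality at the two lower ones.

No matrix inequality is needed. At a maximum of the penalized functional (`exists_max_tripled`), u
is touched by explicit quadratics at each of the three points. Shifting all three points by one
vector leaves the coupling unchanged, so the combined second difference of u is at most that of the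
barrier. The test functions replace u only in a ball of radius R, and their contribution vanishes as
R → 0 because both kernels have order below 2 (`combined_inequality`). Linearity of the fractional
Laplacian, together with convexity, ellipticity and translation invariance of `J`, reduces the
nonlocal terms to the barrier (`fracLaplacian_combination_ge`, `elliptic_combination_le`).

The penalty gradients cancel in the combination. What remains is a barrier error that is small with
β, against a strictly positive gain from differentiating exp(ρt). -/

/-! ### Integrals against the singular kernels -/

/-- In polar coordinates the radial integrand is r^(1-2s) on (0,1] and r^(-1-2s) beyond, integrable
exactly because 0 < s < 1. -/
lemma integrable_min_sq_div_rpow {n : ℕ} (hn : 1 ≤ n) {s : ℝ} (hs : 0 < s) (hs1 : s < 1) :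
    Integrable (fun y : Rn n => min (‖y‖ ^ 2) 1 / ‖y‖ ^ ((n : ℝ) + 2 * s)) := by
  have : Nonempty (Fin n) := ⟨⟨0, hn⟩⟩
  rw [integrable_fun_norm_addHaar (μ := (volume : Measure (Rn n)))
    (f := fun r : ℝ => min (r ^ 2) 1 / r ^ ((n : ℝ) + 2 * s))]
  have hdim : Module.finrank ℝ (Rn n) = n := by simp
  rw [hdim, ← Ioc_union_Ioi_eq_Ioi (zero_le_one : (0 : ℝ) ≤ 1), integrableOn_union]
  have hpow : ∀ r : ℝ, 0 < r → r ^ (n - 1) = r ^ ((n : ℝ) - 1) := by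
    intro r hr
    rw [← Real.rpow_natCast, Nat.cast_sub hn, Nat.cast_one]
  constructor
  · have h : IntegrableOn (fun r : ℝ => r ^ (1 - 2 * s)) (Ioc 0 1) := by
      have := (intervalIntegral.intervalIntegrable_rpow' (a := 0) (b := 1) (r := 1 - 2 * s)
        (by linarith))
      rwa [intervalIntegrable_iff_integrableOn_Ioc_of_le zero_le_one] at this
    refine h.congr_fun ?_ measurableSet_Ioc
    rintro r ⟨hr, hr1⟩
    have h2 : min (r ^ 2) 1 = r ^ (2 : ℝ) := by
      rw [min_eq_left (by nlinarith)]; norm_cast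
    simp only [smul_eq_mul]
    rw [hpow r hr, h2, ← Real.rpow_sub hr, ← Real.rpow_add hr]
    congr 1; ring
  · have h : IntegrableOn (fun r : ℝ => r ^ (-1 - 2 * s)) (Ioi 1) :=
      integrableOn_Ioi_rpow_of_lt (by linarith) one_pos
    refine h.congr_fun ?_ measurableSet_Ioi
    intro r hr1
    have hr1 : 1 < r := hr1
    have hr : 0 < r := by linarith
    have h2 : min (r ^ 2) 1 = r ^ (0 : ℝ) := by
      rw [min_eq_right (by nlinarith)]; simp
    simp only [smul_eq_mul]
    rw [hpow r hr, h2, ← Real.rpow_sub hr, ← Real.rpow_add hr]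
    congr 1; ring

lemma integrable_min_sq_div_rpow_of_le {n : ℕ} (hn : 1 ≤ n) {s : ℝ} (hs : 0 < s) (hs1 : s < 1)
    {f : Rn n → ℝ} (hf : Measurable f) {C : ℝ} (hC : ∀ y, |f y| ≤ C * min (‖y‖ ^ 2) 1) :
    Integrable (fun y : Rn n => f y / ‖y‖ ^ ((n : ℝ) + 2 * s)) := by
  refine ((integrable_min_sq_div_rpow hn hs hs1).const_mul C).mono' ?_ ?_
  · exact (hf.div (by fun_prop)).aestronglyMeasurable
  · refine ae_of_all _ fun y => ?_
    have h0 : 0 ≤ ‖y‖ ^ ((n : ℝ) + 2 * s) := Real.rpow_nonneg (norm_nonneg _) _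
    rw [Real.norm_eq_abs, abs_div, abs_of_nonneg h0, ← mul_div_assoc]
    exact div_le_div_of_nonneg_right (hC y) h0

/-- A family of integrands dominated by `C min(|y|², 1)` and tending pointwise to `0` off the
origin has integrals against the kernel tending to `0`. -/
lemma tendsto_integral_div_rpow {n : ℕ} (hn : 1 ≤ n) {s : ℝ} (hs : 0 < s) (hs1 : s < 1)
    {f : ℝ → Rn n → ℝ} (hf : ∀ R, Measurable (f R))
    (hC : ∀ R, 0 < R → R < 1 → ∀ y, |f R y| ≤ min (‖y‖ ^ 2) 1)
    (h0 : ∀ y : Rn n, y ≠ 0 → Tendsto (fun R => f R y) (𝓝[>] 0) (𝓝 0)) :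
    Tendsto (fun R => ∫ y : Rn n, f R y / ‖y‖ ^ ((n : ℝ) + 2 * s)) (𝓝[>] 0) (𝓝 0) := by
  have h : Tendsto (fun R => ∫ y : Rn n, f R y / ‖y‖ ^ ((n : ℝ) + 2 * s)) (𝓝[>] 0)
      (𝓝 (∫ _y : Rn n, (0 : ℝ))) := by
    refine tendsto_integral_filter_of_dominated_convergence _ ?_ ?_
      (integrable_min_sq_div_rpow hn hs hs1) ?_
    · exact Eventually.of_forall fun R => ((hf R).div (by fun_prop)).aestronglyMeasurable
    · filter_upwards [Ioo_mem_nhdsGT (zero_lt_one : (0 : ℝ) < 1)] with R hR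
      refine ae_of_all _ fun y => ?_
      have h0 : 0 ≤ ‖y‖ ^ ((n : ℝ) + 2 * s) := Real.rpow_nonneg (norm_nonneg _) _
      rw [Real.norm_eq_abs, abs_div, abs_of_nonneg h0]
      exact div_le_div_of_nonneg_right (hC R hR.1 hR.2 y) h0
    · refine ae_of_all _ fun y => ?_
      -- At the origin the kernel's denominator is 0, so the quotient is 0 by the convention for
      -- division.
      by_cases hy : y = 0
      · subst hy
        have hz : (‖(0 : Rn n)‖) ^ ((n : ℝ) + 2 * s) = 0 := by
          rw [norm_zero, Real.zero_rpow]; positivity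
        simp only [hz, div_zero]
        exact tendsto_const_nhds
      · simpa using (h0 y hy).div_const (‖y‖ ^ ((n : ℝ) + 2 * s))
  simpa using h

/-- The contribution of a ball of radius `R` in which a second difference is at most `|y|²`. -/
noncomputable def ballError (n : ℕ) (s R : ℝ) : ℝ :=
  ∫ y : Rn n, (Metric.ball (0 : Rn n) R).indicator (fun y => ‖y‖ ^ 2) y / ‖y‖ ^ ((n : ℝ) + 2 * s)

/-- The contribution of a second difference that is at most `min (β² |y|²) 1`. -/
noncomputable def tailError (n : ℕ) (s β : ℝ) : ℝ :=
  ∫ y : Rn n, min (β ^ 2 * ‖y‖ ^ 2) 1 / ‖y‖ ^ ((n : ℝ) + 2 * s)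

lemma measurable_indicator_norm_sq {n : ℕ} (R : ℝ) :
    Measurable ((Metric.ball (0 : Rn n) R).indicator fun y => ‖y‖ ^ 2) :=
  Measurable.indicator (by fun_prop) measurableSet_ball

lemma abs_indicator_norm_sq_le {n : ℕ} {R : ℝ} (hR1 : R ≤ 1) (y : Rn n) :
    |(Metric.ball (0 : Rn n) R).indicator (fun y => ‖y‖ ^ 2) y| ≤ min (‖y‖ ^ 2) 1 := by
  by_cases hy : y ∈ Metric.ball (0 : Rn n) R
  · rw [indicator_of_mem hy, abs_of_nonneg (by positivity)]
    rw [mem_ball_zero_iff] at hy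
    exact le_min le_rfl (by nlinarith [norm_nonneg y])
  · rw [indicator_of_notMem hy]; simp

lemma abs_min_sq_le {n : ℕ} {β : ℝ} (hβ : 0 < β) (hβ1 : β ≤ 1) (y : Rn n) :
    |min (β ^ 2 * ‖y‖ ^ 2) 1| ≤ min (‖y‖ ^ 2) 1 := by
  rw [abs_of_nonneg (by positivity)]
  refine min_le_min_right _ ?_
  have : β ^ 2 ≤ 1 := by nlinarith
  exact mul_le_of_le_one_left (sq_nonneg _) this

lemma tendsto_ballError {n : ℕ} (hn : 1 ≤ n) {s : ℝ} (hs : 0 < s) (hs1 : s < 1) :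
    Tendsto (ballError n s) (𝓝[>] 0) (𝓝 0) := by
  refine tendsto_integral_div_rpow hn hs hs1 measurable_indicator_norm_sq
    (fun R _ hR1 => abs_indicator_norm_sq_le hR1.le) fun y hy => ?_
  refine tendsto_const_nhds.congr' ?_
  filter_upwards [Ioo_mem_nhdsGT (norm_pos_iff.2 hy)] with R hR
  rw [indicator_of_notMem]
  simpa using hR.2.le

lemma tendsto_tailError {n : ℕ} (hn : 1 ≤ n) {s : ℝ} (hs : 0 < s) (hs1 : s < 1) :
    Tendsto (tailError n s) (𝓝[>] 0) (𝓝 0) := by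
  refine tendsto_integral_div_rpow hn hs hs1 (fun R => by fun_prop)
    (fun R hR hR1 => abs_min_sq_le hR hR1.le) fun y _ => ?_
  have h : Tendsto (fun β : ℝ => min (β ^ 2 * ‖y‖ ^ 2) 1) (𝓝 0) (𝓝 (min (0 ^ 2 * ‖y‖ ^ 2) 1)) :=
    Continuous.tendsto (by fun_prop) 0
  simpa using h.mono_left nhdsWithin_le_nhds

lemma fracConst_nonneg (n : ℕ) {s : ℝ} (hs : 0 < s) (hs1 : s < 1) : 0 ≤ fracConst n s := by
  have h1 : 0 < Real.Gamma ((n : ℝ) / 2 + s) := Real.Gamma_pos_of_pos (by positivity)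
  have h2 : 0 < Real.Gamma (1 - s) := Real.Gamma_pos_of_pos (by linarith)
  unfold fracConst
  positivity

/-! ### Punctual regularity and admissibility -/

/-- `f` is bounded, measurable and differentiable to second order (punctually `C^{1,1}`) at `x`. -/
structure IsRegularAt {n : ℕ} (f : Rn n → ℝ) (x : Rn n) : Prop where
  bounded : ∃ M, ∀ y, |f y| ≤ M
  measurable : Measurable f
  punctual : ∃ p : Rn n, ∃ N : ℝ, ∃ ρ > 0, ∀ y, ‖y‖ < ρ →
    |f (x + y) - f x - inner ℝ p y| ≤ N * ‖y‖ ^ 2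

namespace IsRegularAt
variable {n : ℕ} {f g : Rn n → ℝ} {x : Rn n}

lemma translate (hf : IsRegularAt f x) : IsRegularAt (fun y => f (y + x)) 0 := by
  obtain ⟨⟨M, hM⟩, hm, p, N, ρ, hρ, h⟩ := hf
  refine ⟨⟨M, fun y => hM _⟩, hm.comp (by fun_prop), p, N, ρ, hρ, fun y hy => ?_⟩
  simpa [add_comm] using h y hy

lemma combination (hf : IsRegularAt f x) (hg : IsRegularAt g x) (α γ : ℝ) :
    IsRegularAt (fun y => α * f y + γ * g y) x := by
  obtain ⟨⟨M, hM⟩, hm, p, N, ρ, hρ, h⟩ := hf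
  obtain ⟨⟨M', hM'⟩, hm', p', N', ρ', hρ', h'⟩ := hg
  refine ⟨⟨|α| * M + |γ| * M', fun y => ?_⟩, by fun_prop, α • p + γ • p',
    |α| * N + |γ| * N', min ρ ρ', lt_min hρ hρ', fun y hy => ?_⟩
  · calc |α * f y + γ * g y| ≤ |α * f y| + |γ * g y| := abs_add_le _ _
      _ ≤ _ := by
        rw [abs_mul, abs_mul]
        gcongr
        exacts [hM y, hM' y]
  · have e : α * f (x + y) + γ * g (x + y) - (α * f x + γ * g x) - inner ℝ (α • p + γ • p') y
        = α * (f (x + y) - f x - inner ℝ p y) + γ * (g (x + y) - g x - inner ℝ p' y) := by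
      rw [inner_add_left, real_inner_smul_left, real_inner_smul_left]; ring
    calc _ = |α * (f (x + y) - f x - inner ℝ p y) + γ * (g (x + y) - g x - inner ℝ p' y)| := by
          rw [e]
      _ ≤ |α| * |f (x + y) - f x - inner ℝ p y| + |γ| * |g (x + y) - g x - inner ℝ p' y| := by
          rw [← abs_mul, ← abs_mul]; exact abs_add_le _ _
      _ ≤ |α| * (N * ‖y‖ ^ 2) + |γ| * (N' * ‖y‖ ^ 2) := by
          gcongr
          exacts [h y (hy.trans_le (min_le_left _ _)), h' y (hy.trans_le (min_le_right _ _))]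
      _ = _ := by ring

lemma admissibleAt (hn : 1 ≤ n) {σ : ℝ} (hσ : 0 < σ) (hσ1 : σ < 1) (hf : IsRegularAt f x) :
    AdmissibleAt σ f x := by
  obtain ⟨⟨M, hM⟩, hm, p, N, ρ, hρ, h⟩ := hf
  constructor
  · refine ⟨2 - 2 * σ, by linarith, p, max N 1, by positivity, ρ, hρ, fun hc => by linarith,
      fun y hy => (h y hy).trans ?_⟩
    have : 2 * σ + (2 - 2 * σ) = ((2 : ℕ) : ℝ) := by push_cast; ring
    rw [this, Real.rpow_natCast]
    gcongr
    exact le_max_left _ _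
  · set a : ℝ := (n : ℝ) + 2 * σ with ha
    have ha0 : 0 < a := by positivity
    have hint : Integrable (fun y : Rn n => (1 + ‖y‖) ^ (-a)) :=
      integrable_one_add_norm (by simp [ha]; linarith)
    refine (hint.const_mul (M * 2 ^ a)).mono' ?_ ?_
    · exact (hm.div (by fun_prop)).aestronglyMeasurable
    · refine ae_of_all _ fun y => ?_
      have h0 : 0 ≤ ‖y‖ ^ a := Real.rpow_nonneg (norm_nonneg _) _
      have hM0 : 0 ≤ M := (abs_nonneg _).trans (hM 0)
      rw [Real.norm_eq_abs, abs_div, abs_of_nonneg (by linarith : 0 ≤ 1 + ‖y‖ ^ a)]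
      have hb : (1 + ‖y‖) ^ a ≤ 2 ^ a * (1 + ‖y‖ ^ a) := by
        rcases le_total ‖y‖ 1 with h1 | h1
        · calc (1 + ‖y‖) ^ a ≤ 2 ^ a :=
                Real.rpow_le_rpow (by positivity) (by linarith) ha0.le
            _ ≤ 2 ^ a * (1 + ‖y‖ ^ a) := le_mul_of_one_le_right (by positivity) (by linarith)
        · calc (1 + ‖y‖) ^ a ≤ (2 * ‖y‖) ^ a :=
                Real.rpow_le_rpow (by positivity) (by linarith) ha0.le
            _ = 2 ^ a * ‖y‖ ^ a := Real.mul_rpow (by norm_num) (norm_nonneg _)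
            _ ≤ 2 ^ a * (1 + ‖y‖ ^ a) := by gcongr; linarith
      have hp : 0 < (1 + ‖y‖) ^ a := Real.rpow_pos_of_pos (by positivity) _
      rw [Real.rpow_neg (by positivity), ← div_eq_mul_inv, div_le_div_iff₀ (by linarith) hp]
      calc |f y| * (1 + ‖y‖) ^ a ≤ M * (2 ^ a * (1 + ‖y‖ ^ a)) := by
            gcongr; exact hM y
        _ = _ := by ring

lemma integrable_secondDiff (hn : 1 ≤ n) {s : ℝ} (hs : 0 < s) (hs1 : s < 1)
    (hf : IsRegularAt f x) :
    Integrable (fun y : Rn n => secondDiff f x y / ‖y‖ ^ ((n : ℝ) + 2 * s)) := by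
  obtain ⟨⟨M, hM⟩, hm, p, N, ρ, hρ, h⟩ := hf
  have hM0 : 0 ≤ M := (abs_nonneg _).trans (hM 0)
  set ρ' := min ρ 1
  have hρ' : 0 < ρ' := lt_min hρ one_pos
  -- The first term of the constant serves near the origin, where the linear part cancels by
  -- symmetry; the second serves where ‖y‖ ≥ ρ' and only boundedness is available.
  refine integrable_min_sq_div_rpow_of_le hn hs hs1 (C := 2 * |N| + 4 * M / ρ' ^ 2) ?_ ?_
  · unfold secondDiff
    exact ((hm.comp (by fun_prop)).add (hm.comp (by fun_prop))).sub (by fun_prop)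
  · intro y
    have hc : 0 ≤ 4 * M / ρ' ^ 2 := by positivity
    have hmn : 0 ≤ min (‖y‖ ^ 2) 1 := by positivity
    by_cases hy : ‖y‖ < ρ'
    · have h1 := h y (hy.trans_le (min_le_left _ _))
      have h2 := h (-y) (by rw [norm_neg]; exact hy.trans_le (min_le_left _ _))
      rw [inner_neg_right, norm_neg, ← sub_eq_add_neg] at h2
      have hy1 : ‖y‖ < 1 := hy.trans_le (min_le_right _ _)
      have hmin : min (‖y‖ ^ 2) 1 = ‖y‖ ^ 2 := min_eq_left (by nlinarith [norm_nonneg y])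
      have hN : N * ‖y‖ ^ 2 ≤ |N| * ‖y‖ ^ 2 := by gcongr; exact le_abs_self _
      have hcy : 0 ≤ 4 * M / ρ' ^ 2 * ‖y‖ ^ 2 := by positivity
      rw [hmin]
      unfold secondDiff
      rw [abs_le] at h1 h2 ⊢
      constructor <;> nlinarith
    · push Not at hy
      have hlow : ρ' ^ 2 ≤ min (‖y‖ ^ 2) 1 := by
        refine le_min (by gcongr) ?_
        have : ρ' ≤ 1 := min_le_right _ _
        nlinarith
      have h4 : 4 * M ≤ 4 * M / ρ' ^ 2 * min (‖y‖ ^ 2) 1 := by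
        rw [div_mul_eq_mul_div, le_div_iff₀ (by positivity)]
        gcongr
      have hN : 0 ≤ 2 * |N| * min (‖y‖ ^ 2) 1 := by positivity
      have a1 := abs_le.1 (hM (x + y))
      have a2 := abs_le.1 (hM (x - y))
      have a3 := abs_le.1 (hM x)
      unfold secondDiff
      rw [abs_le]
      constructor <;> nlinarith

end IsRegularAt

/-! ### The nonlocal operators at three points -/

section Comparison
variable {n : ℕ} {v₀ v₁ v₂ : Rn n → ℝ} {x₀ x₁ x₂ : Rn n} {θ : ℝ} {B : Rn n → ℝ}

lemma fracLaplacian_combination_ge (hn : 1 ≤ n) {s : ℝ} (hs : 0 < s) (hs1 : s < 1)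
    (h₀ : IsRegularAt v₀ x₀) (h₁ : IsRegularAt v₁ x₁) (h₂ : IsRegularAt v₂ x₂)
    (hB : ∀ y, secondDiff v₀ x₀ y - θ * secondDiff v₁ x₁ y - (1 - θ) * secondDiff v₂ x₂ y ≤ B y)
    (hBi : Integrable (fun y : Rn n => B y / ‖y‖ ^ ((n : ℝ) + 2 * s))) :
    -(fracConst n s / 2) * ∫ y : Rn n, B y / ‖y‖ ^ ((n : ℝ) + 2 * s) ≤
      fracLaplacian s v₀ x₀ - θ * fracLaplacian s v₁ x₁ - (1 - θ) * fracLaplacian s v₂ x₂ := by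
  have i₀ := h₀.integrable_secondDiff hn hs hs1
  have i₁ := h₁.integrable_secondDiff hn hs hs1
  have i₂ := h₂.integrable_secondDiff hn hs hs1
  have hle : (∫ y : Rn n, (secondDiff v₀ x₀ y / ‖y‖ ^ ((n : ℝ) + 2 * s)
      - θ * (secondDiff v₁ x₁ y / ‖y‖ ^ ((n : ℝ) + 2 * s))
      - (1 - θ) * (secondDiff v₂ x₂ y / ‖y‖ ^ ((n : ℝ) + 2 * s))))
      ≤ ∫ y : Rn n, B y / ‖y‖ ^ ((n : ℝ) + 2 * s) := by
    refine integral_mono ((i₀.sub (i₁.const_mul θ)).sub (i₂.const_mul (1 - θ))) hBi fun y => ?_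
    have h0 : 0 ≤ ‖y‖ ^ ((n : ℝ) + 2 * s) := Real.rpow_nonneg (norm_nonneg _) _
    have := div_le_div_of_nonneg_right (hB y) h0
    rw [sub_div, sub_div, mul_div_assoc, mul_div_assoc] at this
    exact this
  have i₀₁ : Integrable (fun y : Rn n => secondDiff v₀ x₀ y / ‖y‖ ^ ((n : ℝ) + 2 * s)
      - θ * (secondDiff v₁ x₁ y / ‖y‖ ^ ((n : ℝ) + 2 * s))) := i₀.sub (i₁.const_mul θ)
  rw [integral_sub i₀₁ (i₂.const_mul (1 - θ)),
    integral_sub i₀ (i₁.const_mul θ), integral_const_mul, integral_const_mul] at hle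
  have hc := fracConst_nonneg n hs hs1
  unfold fracLaplacian
  nlinarith

/-- Translation invariance moves all three evaluations to the origin. Convexity then bounds `J` of
the combination by the combination of values, and ellipticity compares it with `v₀` through the
extremal operator, whose integrand is at most `Lam * B` over the kernel's denominator since `B` is
nonnegative. -/
lemma elliptic_combination_le (hn : 1 ≤ n) {σ lam Lam : ℝ} (hσ : 0 < σ) (hσ1 : σ < 1)
    (hlam : 0 ≤ lam) (hLam : lam ≤ Lam)
    {J : (Rn n → ℝ) → Rn n → ℝ} (hJ : IsConvexEllipticOperator σ lam Lam J)
    (hθ : 0 ≤ θ) (hθ1 : θ ≤ 1)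
    (h₀ : IsRegularAt v₀ x₀) (h₁ : IsRegularAt v₁ x₁) (h₂ : IsRegularAt v₂ x₂)
    (hB0 : ∀ y, 0 ≤ B y)
    (hB : ∀ y, secondDiff v₀ x₀ y - θ * secondDiff v₁ x₁ y - (1 - θ) * secondDiff v₂ x₂ y ≤ B y)
    (hBi : Integrable (fun y : Rn n => B y / ‖y‖ ^ ((n : ℝ) + 2 * σ))) :
    J v₀ x₀ - θ * J v₁ x₁ - (1 - θ) * J v₂ x₂ ≤
      Lam * ∫ y : Rn n, B y / ‖y‖ ^ ((n : ℝ) + 2 * σ) := by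
  have t₀ := hJ.translation v₀ x₀ 0 (by rw [zero_add]; exact h₀.admissibleAt hn hσ hσ1)
  have t₁ := hJ.translation v₁ x₁ 0 (by rw [zero_add]; exact h₁.admissibleAt hn hσ hσ1)
  have t₂ := hJ.translation v₂ x₂ 0 (by rw [zero_add]; exact h₂.admissibleAt hn hσ hσ1)
  rw [zero_add] at t₀ t₁ t₂
  have hcv := hJ.convex _ _ 0 θ (h₁.translate.admissibleAt hn hσ hσ1)
    (h₂.translate.admissibleAt hn hσ hσ1) hθ hθ1
  have hel := (hJ.elliptic _ _ 0 (h₀.translate.admissibleAt hn hσ hσ1)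
    ((h₁.translate.combination h₂.translate θ (1 - θ)).admissibleAt hn hσ hσ1)).2
  rw [t₁, t₂] at hcv
  rw [t₀] at hel
  have hM : extremalPlus σ lam Lam
      (fun y => v₀ (y + x₀) - (θ * v₁ (y + x₁) + (1 - θ) * v₂ (y + x₂))) 0 ≤
      Lam * ∫ y : Rn n, B y / ‖y‖ ^ ((n : ℝ) + 2 * σ) := by
    unfold extremalPlus
    rw [← integral_const_mul]
    have hL0 : 0 ≤ Lam := hlam.trans hLam
    have hk : ∀ y : Rn n, 0 ≤ ‖y‖ ^ ((n : ℝ) + 2 * σ) := fun y => Real.rpow_nonneg (norm_nonneg _) _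
    -- Without integrability the extremal operator takes the default value 0, and the bound survives
    -- because `B` is nonnegative.
    by_cases hi : Integrable (fun y : Rn n => (Lam * max (secondDiff
        (fun y => v₀ (y + x₀) - (θ * v₁ (y + x₁) + (1 - θ) * v₂ (y + x₂))) 0 y) 0 - lam *
        max (-secondDiff (fun y => v₀ (y + x₀) - (θ * v₁ (y + x₁) + (1 - θ) * v₂ (y + x₂))) 0 y) 0)
        / ‖y‖ ^ ((n : ℝ) + 2 * σ))
    · refine integral_mono hi (hBi.const_mul Lam) fun y => ?_
      have e : secondDiff (fun y => v₀ (y + x₀) - (θ * v₁ (y + x₁) + (1 - θ) * v₂ (y + x₂))) 0 y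
          = secondDiff v₀ x₀ y - θ * secondDiff v₁ x₁ y - (1 - θ) * secondDiff v₂ x₂ y := by
        unfold secondDiff
        simp only [zero_add, zero_sub, add_comm y, neg_add_eq_sub]
        ring
      simp only [e]
      rw [← mul_div_assoc]
      refine div_le_div_of_nonneg_right ?_ (hk y)
      have h1 := mul_le_mul_of_nonneg_left (max_le (hB y) (hB0 y)) hL0
      have h2 := mul_nonneg hlam (le_max_right
        (-(secondDiff v₀ x₀ y - θ * secondDiff v₁ x₁ y - (1 - θ) * secondDiff v₂ x₂ y)) 0)
      linarith
    · rw [integral_undef hi]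
      exact integral_nonneg fun y => mul_nonneg hL0 (div_nonneg (hB0 y) (hk y))
  linarith

end Comparison

/-! ### Quadratic test functions and gluing -/

/-- The function equal to `f x₀ + p·(x - x₀) + N |x - x₀|²` in the ball of radius `R` about `x₀`
and to `f` elsewhere. -/
noncomputable def quadPatch {n : ℕ} (f : Rn n → ℝ) (x₀ p : Rn n) (N R : ℝ) : Rn n → ℝ :=
  fun x => if ‖x - x₀‖ < R then f x₀ + inner ℝ p (x - x₀) + N * ‖x - x₀‖ ^ 2 else f x

section Patch
variable {n : ℕ} {f : Rn n → ℝ} {x₀ p : Rn n} {N R : ℝ}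

lemma quadPatch_add_of_lt {y : Rn n} (hy : ‖y‖ < R) :
    quadPatch f x₀ p N R (x₀ + y) = f x₀ + inner ℝ p y + N * ‖y‖ ^ 2 := by
  simp [quadPatch, hy]

lemma quadPatch_add_of_le {y : Rn n} (hy : R ≤ ‖y‖) :
    quadPatch f x₀ p N R (x₀ + y) = f (x₀ + y) := by
  simp [quadPatch, hy.not_gt]

lemma quadPatch_self (hR : 0 < R) : quadPatch f x₀ p N R x₀ = f x₀ := by
  simp [quadPatch, hR]

lemma isRegularAt_quadPatch (hf : Continuous f) (hM : ∃ M, ∀ x, |f x| ≤ M) (hR : 0 < R) :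
    IsRegularAt (quadPatch f x₀ p N R) x₀ := by
  obtain ⟨M, hM⟩ := hM
  refine ⟨⟨M + ‖p‖ * R + |N| * R ^ 2, fun y => ?_⟩, ?_, p, |N|, R, hR, fun y hy => ?_⟩
  · have h1 : 0 ≤ ‖p‖ * R := by positivity
    have h2 : 0 ≤ |N| * R ^ 2 := by positivity
    unfold quadPatch
    split_ifs with hy
    · have h3 : |inner ℝ p (y - x₀)| ≤ ‖p‖ * R :=
        (abs_real_inner_le_norm _ _).trans (by gcongr)
      have h4 : |N * ‖y - x₀‖ ^ 2| ≤ |N| * R ^ 2 := by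
        rw [abs_mul, abs_of_nonneg (sq_nonneg ‖y - x₀‖)]; gcongr
      exact (abs_add_three _ _ _).trans (by linarith [hM x₀])
    · linarith [hM y]
  · exact Measurable.ite (measurableSet_lt (by fun_prop) (by fun_prop)) (by fun_prop)
      hf.measurable
  · rw [quadPatch_add_of_lt hy, quadPatch_self hR]
    have : f x₀ + inner ℝ p y + N * ‖y‖ ^ 2 - f x₀ - inner ℝ p y = N * ‖y‖ ^ 2 := by ring
    rw [this, abs_mul, abs_of_nonneg (sq_nonneg ‖y‖)]

lemma secondDiff_quadPatch_of_lt {y : Rn n} (hR : 0 < R) (hy : ‖y‖ < R) :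
    secondDiff (quadPatch f x₀ p N R) x₀ y = 2 * N * ‖y‖ ^ 2 := by
  have h2 := quadPatch_add_of_lt (f := f) (x₀ := x₀) (p := p) (N := N) (R := R) (y := -y)
    (by rwa [norm_neg])
  rw [norm_neg, inner_neg_right, ← sub_eq_add_neg] at h2
  rw [secondDiff, h2, quadPatch_add_of_lt hy, quadPatch_self hR]
  ring

lemma secondDiff_quadPatch_of_le {y : Rn n} (hR : 0 < R) (hy : R ≤ ‖y‖) :
    secondDiff (quadPatch f x₀ p N R) x₀ y = secondDiff f x₀ y := by
  have h2 := quadPatch_add_of_le (f := f) (x₀ := x₀) (p := p) (N := N) (R := R) (y := -y)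
    (by rwa [norm_neg])
  rw [← sub_eq_add_neg] at h2
  rw [secondDiff, secondDiff, h2, quadPatch_add_of_le hy, quadPatch_self hR]

end Patch

/-- The quadratic test function with value `c`, time derivative `a`, gradient `p` at `(t₀, x₀)`. -/
noncomputable def quadTest {n : ℕ} (c a : ℝ) (p : Rn n) (N t₀ : ℝ) (x₀ : Rn n) : ℝ → Rn n → ℝ :=
  fun t x => c + a * (t - t₀) + inner ℝ p (x - x₀) + N * ((t - t₀) ^ 2 + ‖x - x₀‖ ^ 2)

section Test
variable {n : ℕ} {c a N t₀ R : ℝ} {p x₀ : Rn n}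

lemma quadTest_self : quadTest c a p N t₀ x₀ t₀ x₀ = c := by simp [quadTest]

lemma hasDerivAt_quadTest (t : ℝ) (x : Rn n) :
    HasDerivAt (fun τ => quadTest c a p N t₀ x₀ τ x) (a + 2 * N * (t - t₀)) t := by
  have h0 : HasDerivAt (fun τ : ℝ => τ - t₀) 1 t := (hasDerivAt_id t).sub_const t₀
  have h := (((h0.const_mul a).const_add c).add_const (inner ℝ p (x - x₀))).add
    (((h0.pow 2).add_const (‖x - x₀‖ ^ 2)).const_mul N)
  refine h.congr_deriv ?_
  simp; ring

lemma hasFDerivAt_quadTest (t : ℝ) (x : Rn n) :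
    HasFDerivAt (quadTest c a p N t₀ x₀ t)
      (innerSL ℝ p + (2 * N) • innerSL ℝ (x - x₀)) x := by
  have h0 : HasFDerivAt (fun x : Rn n => x - x₀) (ContinuousLinearMap.id ℝ (Rn n)) x :=
    (hasFDerivAt_id x).sub_const x₀
  have h1 : HasFDerivAt (fun x : Rn n => inner ℝ p (x - x₀)) (innerSL ℝ p) x := by
    exact (((innerSL ℝ p).hasFDerivAt (x := x - x₀)).comp x h0).congr_fderiv
      (ContinuousLinearMap.comp_id _)
  have h := (h1.const_add (c + a * (t - t₀))).add
    ((h0.norm_sq.const_add ((t - t₀) ^ 2)).const_mul N)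
  refine h.congr_fderiv ?_
  ext y
  simp; ring

lemma isC12OnBall_quadTest : IsC12OnBall (quadTest c a p N t₀ x₀) t₀ x₀ R := by
  refine ⟨fun t _ => a + 2 * N * (t - t₀), fun _ x => innerSL ℝ p + (2 * N) • innerSL ℝ (x - x₀),
    fun _ _ => (2 * N) • innerSL ℝ, ?_, ?_, ?_, ?_, fun t x _ =>
    ⟨hasDerivAt_quadTest t x, hasFDerivAt_quadTest t x, ?_⟩⟩
  · unfold quadTest; fun_prop
  · fun_prop
  · fun_prop
  · fun_prop
  · have h0 : HasFDerivAt (fun x : Rn n => x - x₀) (ContinuousLinearMap.id ℝ (Rn n)) x :=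
      (hasFDerivAt_id x).sub_const x₀
    have h1 : HasFDerivAt (fun x : Rn n => innerSL ℝ (x - x₀)) (innerSL ℝ (E := Rn n)) x := by
      exact (((innerSL ℝ (E := Rn n)).hasFDerivAt (x := x - x₀)).comp x h0).congr_fderiv
        (ContinuousLinearMap.comp_id _)
    exact (h1.const_smul (2 * N)).const_add _

lemma stBall_mem_nhds (hR : 0 < R) : stBall t₀ x₀ R ∈ 𝓝 (t₀, x₀) := by
  refine IsOpen.mem_nhds (isOpen_lt (by fun_prop) (by fun_prop)) ?_
  simp [stBall]; positivity

lemma slice_mem_stBall (hR : 0 < R) {x : Rn n} : (t₀, x) ∈ stBall t₀ x₀ R ↔ ‖x - x₀‖ < R := by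
  simp only [stBall, mem_ofPred_eq, sub_self]
  rw [zero_pow two_ne_zero, zero_add]
  exact sq_lt_sq₀ (norm_nonneg _) hR.le

variable {u : ℝ → Rn n → ℝ}

lemma glue_quadTest_slice (hR : 0 < R) (hc : c = u t₀ x₀) :
    glue (quadTest c a p N t₀ x₀) u t₀ x₀ R t₀ = quadPatch (u t₀) x₀ p N R := by
  funext x
  simp only [glue, quadPatch, slice_mem_stBall hR, quadTest, hc]
  simp

lemma parabolicOp_glue_quadTest (hR : 0 < R) (hc : c = u t₀ x₀) (s : ℝ) (b : Rn n) (r : ℝ)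
    (J : (Rn n → ℝ) → Rn n → ℝ) :
    parabolicOp s b r J (glue (quadTest c a p N t₀ x₀) u t₀ x₀ R) t₀ x₀ =
      a + fracLaplacian s (quadPatch (u t₀) x₀ p N R) x₀ - inner ℝ p b
        - J (quadPatch (u t₀) x₀ p N R) x₀ - r * u t₀ x₀ := by
  have hev := stBall_mem_nhds (t₀ := t₀) (x₀ := x₀) hR
  have hd : deriv (fun τ => glue (quadTest c a p N t₀ x₀) u t₀ x₀ R τ x₀) t₀ = a := by
    have h1 : (fun τ => glue (quadTest c a p N t₀ x₀) u t₀ x₀ R τ x₀) =ᶠ[𝓝 t₀]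
        fun τ => quadTest c a p N t₀ x₀ τ x₀ := by
      have h2 : Tendsto (fun τ : ℝ => (τ, x₀)) (𝓝 t₀) (𝓝 (t₀, x₀)) :=
        Continuous.tendsto (by fun_prop) t₀
      filter_upwards [h2 hev] with τ hτ
      exact if_pos hτ
    rw [h1.deriv_eq, (hasDerivAt_quadTest t₀ x₀).deriv]
    simp
  have hf : fderiv ℝ (glue (quadTest c a p N t₀ x₀) u t₀ x₀ R t₀) x₀ b = inner ℝ p b := by
    have h1 : glue (quadTest c a p N t₀ x₀) u t₀ x₀ R t₀ =ᶠ[𝓝 x₀] quadTest c a p N t₀ x₀ t₀ := by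
      have h2 : Tendsto (fun x : Rn n => (t₀, x)) (𝓝 x₀) (𝓝 (t₀, x₀)) :=
        Continuous.tendsto (by fun_prop) x₀
      filter_upwards [h2 hev] with x hx
      exact if_pos hx
    rw [h1.fderiv_eq, (hasFDerivAt_quadTest t₀ x₀).fderiv]
    simp
  rw [parabolicOp, hd, hf, glue_quadTest_slice hR hc, quadPatch_self hR]

variable {T s r : ℝ} {b : Rn n} {J : (Rn n → ℝ) → Rn n → ℝ}

lemma sq_add_norm_sq_pos {t : ℝ} {x : Rn n} (h : (t, x) ≠ (t₀, x₀)) :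
    0 < (t - t₀) ^ 2 + ‖x - x₀‖ ^ 2 := by
  by_cases ht : t = t₀
  · have hx : x ≠ x₀ := fun hx => h (by rw [ht, hx])
    have := norm_pos_iff.2 (sub_ne_zero.2 hx)
    positivity
  · have := sub_ne_zero.2 ht
    positivity

/-- The viscosity subsolution inequality for a function touched from above (not necessarily
strictly) by a quadratic polynomial. -/
lemma ViscositySubAt.quadratic (h : ViscositySubAt T s b r J u t₀ x₀) (hR : 0 < R)
    (htouch : ∀ t x, t ∈ Ioc 0 T → (t, x) ∈ stBall t₀ x₀ R →
      u t x ≤ quadTest (u t₀ x₀) a p N t₀ x₀ t x) :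
    a + fracLaplacian s (quadPatch (u t₀) x₀ p (N + 1) R) x₀ - inner ℝ p b
        - J (quadPatch (u t₀) x₀ p (N + 1) R) x₀ - r * u t₀ x₀ ≤ 0 := by
  -- Adding 1 to the quadratic coefficient makes the touching strict away from the base point. The
  -- patch is altered only inside the ball.
  have := h (quadTest (u t₀ x₀) a p (N + 1) t₀ x₀) R hR isC12OnBall_quadTest
    (by rw [quadTest_self, sub_self]) fun t x ht hx hne => ?_
  · rwa [parabolicOp_glue_quadTest hR rfl] at this
  · have h1 := htouch t x ht hx
    have h2 := sq_add_norm_sq_pos hne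
    unfold quadTest at *
    linarith

lemma ViscositySuperAt.quadratic (h : ViscositySuperAt T s b r J u t₀ x₀) (hR : 0 < R)
    (htouch : ∀ t x, t ∈ Ioc 0 T → (t, x) ∈ stBall t₀ x₀ R →
      quadTest (u t₀ x₀) a p N t₀ x₀ t x ≤ u t x) :
    0 ≤ a + fracLaplacian s (quadPatch (u t₀) x₀ p (N - 1) R) x₀ - inner ℝ p b
        - J (quadPatch (u t₀) x₀ p (N - 1) R) x₀ - r * u t₀ x₀ := by
  have := h (quadTest (u t₀ x₀) a p (N - 1) t₀ x₀) R hR isC12OnBall_quadTest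
    (by rw [quadTest_self, sub_self]) fun t x ht hx hne => ?_
  · rwa [parabolicOp_glue_quadTest hR rfl] at this
  · have h1 := htouch t x ht hx
    have h2 := sq_add_norm_sq_pos hne
    unfold quadTest at *
    linarith

end Test

/-! ### Combining the three viscosity inequalities -/

namespace IsObstacleSolution
variable {n : ℕ} {T s : ℝ} {b : Rn n} {r : ℝ} {J : (Rn n → ℝ) → Rn n → ℝ} {ψ : Rn n → ℝ}
  {u : ℝ → Rn n → ℝ}

lemma continuous_slice (hu : IsObstacleSolution T s b r J ψ u) {t : ℝ} (ht : t ∈ Icc 0 T) :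
    Continuous (u t) := by
  have h : Continuous fun x : Rn n => (t, x) := by fun_prop
  exact hu.continuous.comp_continuous h fun x => ⟨ht, mem_univ x⟩

lemma obstacle_le (hu : IsObstacleSolution T s b r J ψ u) {t : ℝ} (ht : t ∈ Icc 0 T) (x : Rn n) :
    ψ x ≤ u t x := by
  rcases ht.1.eq_or_lt with h | h
  · rw [← h]; exact hu.super.initial x
  · exact hu.super.above t ⟨h, ht.2⟩ x

/-- Suppose that `u` is touched from above by a quadratic polynomial at `(t, x)` and from below at
`(s₁, y₁)` and `(s₂, y₂)`, and that the combination of the translates has its second difference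
bounded by `κ min(β² |y|², 1)`. Then the equations at the three points combine. -/
lemma combined_inequality (hn : 1 ≤ n) {σ lam Lam : ℝ} (hs0 : 0 < s) (hs1 : s < 1) (hσ : 0 < σ)
    (hσ1 : σ < 1) (hlam : 0 ≤ lam) (hLam : lam ≤ Lam) (hJ : IsConvexEllipticOperator σ lam Lam J)
    (hu : IsObstacleSolution T s b r J ψ u) {θ : ℝ} (hθ : 0 ≤ θ) (hθ1 : θ ≤ 1)
    {t s₁ s₂ : ℝ} {x y₁ y₂ : Rn n} (ht : t ∈ Ioc 0 T) (hs₁ : s₁ ∈ Ioc 0 T) (hs₂ : s₂ ∈ Ioc 0 T)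
    (hψu : ψ x < u t x) {a₀ a₁ a₂ N₀ N₁ R₀ : ℝ} {p₀ p₁ p₂ : Rn n}
    (hN₀ : 0 ≤ N₀) (hN₁ : 0 ≤ N₁) (hR₀ : 0 < R₀)
    (htouch₀ : ∀ τ z, τ ∈ Ioc 0 T → |τ - t| ≤ R₀ → u τ z ≤ quadTest (u t x) a₀ p₀ N₀ t x τ z)
    (htouch₁ : ∀ τ z, τ ∈ Ioc 0 T → |τ - s₁| ≤ R₀ →
      quadTest (u s₁ y₁) a₁ p₁ (-N₁) s₁ y₁ τ z ≤ u τ z)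
    (htouch₂ : ∀ τ z, τ ∈ Ioc 0 T → |τ - s₂| ≤ R₀ →
      quadTest (u s₂ y₂) a₂ p₂ (-N₁) s₂ y₂ τ z ≤ u τ z)
    {κ β : ℝ} (hκ : 0 ≤ κ) (hβ : 0 < β) (hβ1 : β ≤ 1)
    (hδ : ∀ y, secondDiff (u t) x y - θ * secondDiff (u s₁) y₁ y - (1 - θ) * secondDiff (u s₂) y₂ y
      ≤ κ * min (β ^ 2 * ‖y‖ ^ 2) 1) :
    (a₀ - θ * a₁ - (1 - θ) * a₂) - inner ℝ (p₀ - θ • p₁ - (1 - θ) • p₂) b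
        - r * (u t x - θ * u s₁ y₁ - (1 - θ) * u s₂ y₂) ≤
      κ * (fracConst n s / 2 * tailError n s β + Lam * tailError n σ β) := by
  -- Inside the ball the patches have second differences 2(N₀+1)‖y‖² and -2(N₁+1)‖y‖²; the two lower
  -- ones have total weight 1.
  set K : ℝ := 2 * (N₀ + 1) + 2 * (N₁ + 1) with hK
  have hK0 : 0 ≤ K := by positivity
  have bdd : ∀ {τ}, τ ∈ Ioc 0 T → ∃ M, ∀ z, |u τ z| ≤ M := fun hτ => by
    obtain ⟨M, hM⟩ := hu.sub.bounded
    exact ⟨M, hM _ ⟨hτ.1.le, hτ.2⟩⟩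
  have cts : ∀ {τ}, τ ∈ Ioc 0 T → Continuous (u τ) := fun hτ =>
    hu.continuous_slice ⟨hτ.1.le, hτ.2⟩
  have hmain : ∀ R ∈ Ioo 0 (min R₀ 1),
      (a₀ - θ * a₁ - (1 - θ) * a₂) - inner ℝ (p₀ - θ • p₁ - (1 - θ) • p₂) b
        - r * (u t x - θ * u s₁ y₁ - (1 - θ) * u s₂ y₂) ≤
      fracConst n s / 2 * (K * ballError n s R + κ * tailError n s β)
        + Lam * (K * ballError n σ R + κ * tailError n σ β) := by
    rintro R ⟨hR, hRlt⟩
    have hRR₀ : R ≤ R₀ := (hRlt.trans_le (min_le_left _ _)).le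
    have hR1 : R ≤ 1 := (hRlt.trans_le (min_le_right _ _)).le
    have near : ∀ {t₀ : ℝ} {x₀ : Rn n} {τ z}, (τ, z) ∈ stBall t₀ x₀ R → |τ - t₀| ≤ R₀ := by
      intro t₀ x₀ τ z h
      have h' : (τ - t₀) ^ 2 + ‖z - x₀‖ ^ 2 < R ^ 2 := h
      refine le_trans (abs_le_of_sq_le_sq ?_ hR.le) hRR₀
      nlinarith [sq_nonneg ‖z - x₀‖]
    have e₀ := (hu.sub.viscosity t ht x hψu).quadratic (N := N₀) (a := a₀) (p := p₀) hR
      fun τ z hτ hz => htouch₀ τ z hτ (near hz)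
    have e₁ := (hu.super.viscosity s₁ hs₁ y₁).quadratic (N := -N₁) (a := a₁) (p := p₁) hR
      fun τ z hτ hz => htouch₁ τ z hτ (near hz)
    have e₂ := (hu.super.viscosity s₂ hs₂ y₂).quadratic (N := -N₁) (a := a₂) (p := p₂) hR
      fun τ z hτ hz => htouch₂ τ z hτ (near hz)
    have r₀ := isRegularAt_quadPatch (x₀ := x) (p := p₀) (N := N₀ + 1) (cts ht) (bdd ht) hR
    have r₁ := isRegularAt_quadPatch (x₀ := y₁) (p := p₁) (N := -N₁ - 1) (cts hs₁) (bdd hs₁) hR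
    have r₂ := isRegularAt_quadPatch (x₀ := y₂) (p := p₂) (N := -N₁ - 1) (cts hs₂) (bdd hs₂) hR
    set B : Rn n → ℝ := fun y => K * (Metric.ball (0 : Rn n) R).indicator (fun y => ‖y‖ ^ 2) y
      + κ * min (β ^ 2 * ‖y‖ ^ 2) 1 with hB
    have hmin0 : ∀ y : Rn n, 0 ≤ min (β ^ 2 * ‖y‖ ^ 2) 1 := fun y => by positivity
    have hB0 : ∀ y, 0 ≤ B y := fun y =>
      add_nonneg (mul_nonneg hK0 (indicator_nonneg (fun _ _ => by positivity) _))
        (mul_nonneg hκ (hmin0 y))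
    have hBle : ∀ y, secondDiff (quadPatch (u t) x p₀ (N₀ + 1) R) x y
        - θ * secondDiff (quadPatch (u s₁) y₁ p₁ (-N₁ - 1) R) y₁ y
        - (1 - θ) * secondDiff (quadPatch (u s₂) y₂ p₂ (-N₁ - 1) R) y₂ y ≤ B y := by
      intro y
      rcases lt_or_ge ‖y‖ R with hy | hy
      · rw [secondDiff_quadPatch_of_lt hR hy, secondDiff_quadPatch_of_lt hR hy,
          secondDiff_quadPatch_of_lt hR hy]
        have : B y = K * ‖y‖ ^ 2 + κ * min (β ^ 2 * ‖y‖ ^ 2) 1 := by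
          simp [hB, hy]
        rw [this]
        have := mul_nonneg hκ (hmin0 y)
        simp only [hK]
        linarith
      · rw [secondDiff_quadPatch_of_le hR hy, secondDiff_quadPatch_of_le hR hy,
          secondDiff_quadPatch_of_le hR hy]
        have : B y = κ * min (β ^ 2 * ‖y‖ ^ 2) 1 := by
          simp [hB, hy]
        rw [this]
        exact hδ y
    have hBint : ∀ {ς : ℝ}, 0 < ς → ς < 1 →
        Integrable (fun y : Rn n => B y / ‖y‖ ^ ((n : ℝ) + 2 * ς)) ∧
        ∫ y : Rn n, B y / ‖y‖ ^ ((n : ℝ) + 2 * ς) =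
          K * ballError n ς R + κ * tailError n ς β := by
      intro ς h0 h1
      have i₁ := (integrable_min_sq_div_rpow_of_le hn h0 h1 (measurable_indicator_norm_sq R)
        (C := 1) (fun y => by simpa using abs_indicator_norm_sq_le hR1 y)).const_mul K
      have i₂ := (integrable_min_sq_div_rpow_of_le hn h0 h1
        (f := fun y : Rn n => min (β ^ 2 * ‖y‖ ^ 2) 1) (by fun_prop)
        (C := 1) (fun y => by simpa using abs_min_sq_le hβ hβ1 y)).const_mul κ
      have e : (fun y : Rn n => B y / ‖y‖ ^ ((n : ℝ) + 2 * ς)) = fun y =>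
          K * ((Metric.ball (0 : Rn n) R).indicator (fun y => ‖y‖ ^ 2) y / ‖y‖ ^ ((n : ℝ) + 2 * ς))
          + κ * (min (β ^ 2 * ‖y‖ ^ 2) 1 / ‖y‖ ^ ((n : ℝ) + 2 * ς)) := by
        funext y; simp only [hB]; ring
      rw [e]
      exact ⟨i₁.add i₂, by rw [integral_add i₁ i₂, integral_const_mul, integral_const_mul]; rfl⟩
    have f := fracLaplacian_combination_ge hn hs0 hs1 r₀ r₁ r₂ hBle (hBint hs0 hs1).1
    have g := elliptic_combination_le hn hσ hσ1 hlam hLam hJ hθ hθ1 r₀ r₁ r₂ hB0 hBle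
      (hBint hσ hσ1).1
    rw [(hBint hs0 hs1).2] at f
    rw [(hBint hσ hσ1).2] at g
    have m₁ := mul_nonneg hθ e₁
    have m₂ := mul_nonneg (sub_nonneg.2 hθ1) e₂
    rw [inner_sub_left, inner_sub_left, real_inner_smul_left, real_inner_smul_left]
    linarith
  -- The left side of `hmain` is free of R, so the radius may shrink and the curvature of the test
  -- functions, however large, disappears.
  have hlim : Tendsto (fun R => fracConst n s / 2 * (K * ballError n s R + κ * tailError n s β)
        + Lam * (K * ballError n σ R + κ * tailError n σ β)) (𝓝[>] 0)
      (𝓝 (fracConst n s / 2 * (K * 0 + κ * tailError n s β)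
        + Lam * (K * 0 + κ * tailError n σ β))) :=
    ((((tendsto_ballError hn hs0 hs1).const_mul K).add_const _).const_mul _).add
      ((((tendsto_ballError hn hσ hσ1).const_mul K).add_const _).const_mul _)
  have := ge_of_tendsto hlim (by
    filter_upwards [Ioo_mem_nhdsGT (lt_min hR₀ one_pos)] with R hR using hmain R hR)
  linarith

end IsObstacleSolution

/-! ### The barrier at infinity -/

/-- A smooth bounded function growing from `0` at the origin to `A` at infinity on the length scale
`1 / β`. -/
noncomputable def barrier {n : ℕ} (A β : ℝ) (x : Rn n) : ℝ := A * (1 - (1 + β ^ 2 * ‖x‖ ^ 2)⁻¹)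

/-- The gradient of `barrier`. -/
noncomputable def barrierGrad {n : ℕ} (A β : ℝ) (x : Rn n) : Rn n :=
  (2 * A * β ^ 2 / (1 + β ^ 2 * ‖x‖ ^ 2) ^ 2) • x

section Barrier
variable {n : ℕ} {A β : ℝ}

lemma barrier_nonneg (hA : 0 ≤ A) (x : Rn n) : 0 ≤ barrier A β x := by
  refine mul_nonneg hA (sub_nonneg.2 (inv_le_one_of_one_le₀ ?_))
  have : 0 ≤ β ^ 2 * ‖x‖ ^ 2 := by positivity
  linarith

lemma barrier_le (hA : 0 ≤ A) (x : Rn n) : barrier A β x ≤ A := by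
  refine mul_le_of_le_one_right hA ?_
  have : 0 ≤ (1 + β ^ 2 * ‖x‖ ^ 2)⁻¹ := by positivity
  linarith

lemma half_le_barrier (hA : 0 ≤ A) {x : Rn n} (hx : 1 ≤ β ^ 2 * ‖x‖ ^ 2) :
    A / 2 ≤ barrier A β x := by
  have : (1 + β ^ 2 * ‖x‖ ^ 2)⁻¹ ≤ 2⁻¹ := inv_anti₀ (by norm_num) (by linarith)
  have := mul_le_mul_of_nonneg_left this hA
  unfold barrier
  linarith

lemma continuous_barrier : Continuous (barrier A β : Rn n → ℝ) := by
  unfold barrier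
  refine continuous_const.mul (continuous_const.sub (Continuous.inv₀ (by fun_prop) fun x => ?_))
  positivity

lemma tendsto_barrier (x : Rn n) : Tendsto (fun β => barrier A β x) (𝓝[>] 0) (𝓝 0) := by
  have h : Continuous fun β : ℝ => barrier A β x := by
    unfold barrier
    refine continuous_const.mul (continuous_const.sub (Continuous.inv₀ (by fun_prop) fun x => ?_))
    positivity
  have h0 : barrier A 0 x = 0 := by simp [barrier]
  simpa [h0] using (h.tendsto 0).mono_left nhdsWithin_le_nhds

/-- Convexity of m ↦ 1/(1+m): the tangent line at m = β²‖x‖² lies below the graph, and the increment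
of m is β²(2x·y + ‖y‖²). Its linear part is the gradient term and its quadratic part the remainder.
-/
lemma barrier_add_le (hA : 0 ≤ A) (x y : Rn n) :
    barrier A β (x + y) ≤ barrier A β x + inner ℝ (barrierGrad A β x) y + A * β ^ 2 * ‖y‖ ^ 2 := by
  set m : ℝ := β ^ 2 * ‖x‖ ^ 2 with hm
  set d : ℝ := β ^ 2 * (2 * inner ℝ x y + ‖y‖ ^ 2) with hd
  have hm0 : 0 ≤ m := by positivity
  have hmd : β ^ 2 * ‖x + y‖ ^ 2 = m + d := by rw [norm_add_sq_real, hm, hd]; ring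
  have hmd0 : 0 ≤ m + d := by rw [← hmd]; positivity
  have key : (1 + m)⁻¹ - d / (1 + m) ^ 2 ≤ (1 + (m + d))⁻¹ := by
    have h1 : 0 < 1 + m := by linarith
    have h2 : 0 < 1 + (m + d) := by linarith
    have e : (1 + (m + d))⁻¹ - ((1 + m)⁻¹ - d / (1 + m) ^ 2)
        = d ^ 2 / ((1 + m) ^ 2 * (1 + (m + d))) := by
      field_simp; ring
    have : 0 ≤ d ^ 2 / ((1 + m) ^ 2 * (1 + (m + d))) := by positivity
    linarith
  have hq : 1 / (1 + m) ^ 2 ≤ 1 := by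
    rw [div_le_one (by positivity)]; nlinarith
  have hq' : A * β ^ 2 * ‖y‖ ^ 2 * (1 / (1 + m) ^ 2) ≤ A * β ^ 2 * ‖y‖ ^ 2 :=
    mul_le_of_le_one_right (by positivity) hq
  have key' := mul_le_mul_of_nonneg_left key hA
  unfold barrier barrierGrad
  rw [hmd, real_inner_smul_left, ← hm]
  have e2 : A * (d / (1 + m) ^ 2) = 2 * A * β ^ 2 / (1 + m) ^ 2 * inner ℝ x y
      + A * β ^ 2 * ‖y‖ ^ 2 * (1 / (1 + m) ^ 2) := by
    rw [hd]; ring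
  linarith

lemma inner_barrierGrad_le (hA : 0 ≤ A) (hβ : 0 ≤ β) (x b : Rn n) :
    inner ℝ (barrierGrad A β x) b ≤ A * β * ‖b‖ := by
  refine (real_inner_le_norm _ _).trans (mul_le_mul_of_nonneg_right ?_ (norm_nonneg _))
  unfold barrierGrad
  rw [norm_smul, Real.norm_eq_abs, abs_of_nonneg (by positivity), div_mul_eq_mul_div,
    div_le_iff₀ (by positivity)]
  -- With z = β‖x‖, this is 2z ≤ 1 + z² ≤ (1 + z²)².
  have h : 2 * (β * ‖x‖) ≤ (1 + β ^ 2 * ‖x‖ ^ 2) ^ 2 := by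
    have h0 : 0 ≤ β ^ 2 * ‖x‖ ^ 2 := by positivity
    nlinarith [sq_nonneg (β * ‖x‖ - 1)]
  have := mul_le_mul_of_nonneg_left h (mul_nonneg hA hβ)
  linarith

/-- The quadratic bound comes from `barrier_add_le` at y and -y, the constant one from 0 ≤ barrier ≤
A. Having both makes the nonlocal error vanish as β → 0 (`tendsto_tailError`). -/
lemma secondDiff_barrier_le (hA : 0 ≤ A) (x y : Rn n) :
    secondDiff (barrier A β) x y ≤ 2 * A * min (β ^ 2 * ‖y‖ ^ 2) 1 := by
  rw [mul_min_of_nonneg _ _ (by positivity), mul_one]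
  have h1 := barrier_add_le (β := β) hA x y
  have h2 := barrier_add_le (β := β) hA x (-y)
  rw [norm_neg, inner_neg_right, ← sub_eq_add_neg] at h2
  unfold secondDiff
  refine le_min (by linarith) ?_
  linarith [barrier_le (β := β) hA (x + y), barrier_le (β := β) hA (x - y),
    barrier_nonneg (β := β) hA x]

end Barrier

/-! ### The tripled functional and its maxima -/

/-- The quadratic coupling between the points `x`, `y₁ - h`, `y₂ - k` and the times `t`, `s₁ - τ`,
`s₂ - τ`. -/
noncomputable def coupling {n : ℕ} (θ τ : ℝ) (h k : Rn n) (t : ℝ) (x : Rn n) (s₁ : ℝ) (y₁ : Rn n)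
    (s₂ : ℝ) (y₂ : Rn n) : ℝ :=
  θ * ((s₁ - τ - t) ^ 2 + ‖y₁ - h - x‖ ^ 2) + (1 - θ) * ((s₂ - τ - t) ^ 2 + ‖y₂ - k - x‖ ^ 2)

/-- The functional with tripled variables whose maxima are studied in the comparison argument. -/
noncomputable def tripled {n : ℕ} (u : ℝ → Rn n → ℝ) (θ τ : ℝ) (h k : Rn n) (S ρ A β L t : ℝ)
    (x : Rn n) (s₁ : ℝ) (y₁ : Rn n) (s₂ : ℝ) (y₂ : Rn n) : ℝ :=
  u t x - θ * u s₁ y₁ - (1 - θ) * u s₂ y₂ - S * exp (ρ * t) - barrier A β x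
    - L * coupling θ τ h k t x s₁ y₁ s₂ y₂

lemma sq_sub_eq_expand (a t t' : ℝ) :
    (a - t') ^ 2 = (a - t) ^ 2 - 2 * (a - t) * (t' - t) + (t' - t) ^ 2 := by ring

lemma norm_sq_sub_eq_expand {n : ℕ} (a x x' : Rn n) :
    ‖a - x'‖ ^ 2 = ‖a - x‖ ^ 2 - 2 * inner ℝ (a - x) (x' - x) + ‖x' - x‖ ^ 2 := by
  rw [← norm_sub_sq_real]; congr 2; abel

lemma norm_sq_sub_sub_eq_expand {n : ℕ} (h x y y' : Rn n) :
    ‖y' - h - x‖ ^ 2 = ‖y - h - x‖ ^ 2 + 2 * inner ℝ (y - h - x) (y' - y) + ‖y' - y‖ ^ 2 := by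
  rw [← norm_add_sq_real]; congr 2; abel

lemma exp_mul_le_quadratic {ρ t t' : ℝ} (hρ : 0 < ρ) (h : |t' - t| ≤ ρ⁻¹) :
    exp (ρ * t') ≤ exp (ρ * t) * (1 + ρ * (t' - t) + ρ ^ 2 * (t' - t) ^ 2) := by
  have h1 : |ρ * (t' - t)| ≤ 1 := by
    rw [abs_mul, abs_of_pos hρ]
    calc ρ * |t' - t| ≤ ρ * ρ⁻¹ := by gcongr
      _ = 1 := mul_inv_cancel₀ hρ.ne'
  have h2 := (abs_le.1 (Real.abs_exp_sub_one_sub_id_le h1)).2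
  have e : exp (ρ * t') = exp (ρ * t) * exp (ρ * (t' - t)) := by
    rw [← Real.exp_add]; congr 1; ring
  rw [e]
  gcongr
  nlinarith

namespace IsObstacleSolution
variable {n : ℕ} {T s : ℝ} {b : Rn n} {r : ℝ} {J : (Rn n → ℝ) → Rn n → ℝ} {ψ : Rn n → ℝ}
  {u : ℝ → Rn n → ℝ}

/-- The inequality obtained from the equations at a maximum point of the tripled functional. -/
lemma inequality_at_max (hn : 1 ≤ n) {σ lam Lam : ℝ} (hs0 : 0 < s) (hs1 : s < 1) (hσ : 0 < σ)
    (hσ1 : σ < 1) (hlam : 0 ≤ lam) (hLam : lam ≤ Lam) (hJ : IsConvexEllipticOperator σ lam Lam J)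
    (hu : IsObstacleSolution T s b r J ψ u) {θ τ : ℝ} (hθ : 0 < θ) (hθ1 : θ < 1) (hτ : 0 ≤ τ)
    {h k : Rn n} {S ρ A β L : ℝ} (hS : 0 ≤ S) (hρ : 0 < ρ) (hA : 0 ≤ A) (hβ : 0 < β) (hβ1 : β ≤ 1)
    (hL : 0 ≤ L) {t s₁ s₂ : ℝ} {x y₁ y₂ : Rn n} (ht : t ∈ Ioc 0 T) (hs₁ : s₁ ∈ Ioc τ T)
    (hs₂ : s₂ ∈ Ioc τ T) (hψu : ψ x < u t x)
    (hmax : ∀ t' x' s₁' y₁' s₂' y₂', t' ∈ Icc 0 T → s₁' ∈ Icc τ T → s₂' ∈ Icc τ T →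
      tripled u θ τ h k S ρ A β L t' x' s₁' y₁' s₂' y₂' ≤
        tripled u θ τ h k S ρ A β L t x s₁ y₁ s₂ y₂) :
    S * ρ * exp (ρ * t) - r * (u t x - θ * u s₁ y₁ - (1 - θ) * u s₂ y₂) ≤
      A * β * ‖b‖ + 2 * A * (fracConst n s / 2 * tailError n s β + Lam * tailError n σ β) := by
  have ht' : t ∈ Icc 0 T := Ioc_subset_Icc_self ht
  have hs₁' := Ioc_subset_Icc_self hs₁
  have hs₂' := Ioc_subset_Icc_self hs₂
  have hθ1' : 0 < 1 - θ := by linarith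
  -- The bound by ρ⁻¹ validates the quadratic estimate of the exponential; the other two keep the
  -- perturbed lower times at least τ, where the maximality hypothesis applies.
  set R₀ : ℝ := min ρ⁻¹ (min (s₁ - τ) (s₂ - τ)) with hR₀def
  have hR₀ : 0 < R₀ :=
    lt_min (inv_pos.2 hρ) (lt_min (sub_pos.2 hs₁.1) (sub_pos.2 hs₂.1))
  have hR₀ρ : R₀ ≤ ρ⁻¹ := min_le_left _ _
  have hR₀1 : R₀ ≤ s₁ - τ := (min_le_right _ _).trans (min_le_left _ _)
  have hR₀2 : R₀ ≤ s₂ - τ := (min_le_right _ _).trans (min_le_right _ _)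
  have key := combined_inequality hn hs0 hs1 hσ hσ1 hlam hLam hJ hu hθ.le hθ1.le ht
    (s₁ := s₁) (s₂ := s₂) (y₁ := y₁) (y₂ := y₂)
    ⟨hτ.trans_lt hs₁.1, hs₁.2⟩ ⟨hτ.trans_lt hs₂.1, hs₂.2⟩ hψu (R₀ := R₀)
    -- The slopes are the derivatives of the penalty terms at the maximum, so the L-dependent parts
    -- cancel in the weighted combination. The curvature `N₀` does depend on L, which is harmless
    -- since the radius of the test ball was sent to 0.
    (a₀ := S * ρ * exp (ρ * t) - 2 * L * (θ * (s₁ - τ - t) + (1 - θ) * (s₂ - τ - t)))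
    (p₀ := barrierGrad A β x - (2 * L) • (θ • (y₁ - h - x) + (1 - θ) • (y₂ - k - x)))
    (a₁ := -(2 * L * (s₁ - τ - t))) (a₂ := -(2 * L * (s₂ - τ - t)))
    (p₁ := -((2 * L) • (y₁ - h - x))) (p₂ := -((2 * L) • (y₂ - k - x)))
    (N₀ := L + A * β ^ 2 + S * exp (ρ * t) * ρ ^ 2) (N₁ := L) (by positivity) hL hR₀
    ?_ ?_ ?_ (κ := 2 * A) (by positivity) hβ hβ1 ?_
  · have e₁ : S * ρ * exp (ρ * t) - 2 * L * (θ * (s₁ - τ - t) + (1 - θ) * (s₂ - τ - t))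
        - θ * -(2 * L * (s₁ - τ - t)) - (1 - θ) * -(2 * L * (s₂ - τ - t))
        = S * ρ * exp (ρ * t) := by ring
    have e₂ : barrierGrad A β x - (2 * L) • (θ • (y₁ - h - x) + (1 - θ) • (y₂ - k - x))
        - θ • -((2 * L) • (y₁ - h - x)) - (1 - θ) • -((2 * L) • (y₂ - k - x))
        = barrierGrad A β x := by module
    rw [e₁, e₂] at key
    linarith [inner_barrierGrad_le hA hβ.le x b]
  · intro t' x' ht'' htt
    have hm := hmax t' x' s₁ y₁ s₂ y₂ (Ioc_subset_Icc_self ht'') hs₁' hs₂'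
    have hexp := mul_le_mul_of_nonneg_left (exp_mul_le_quadratic hρ (htt.trans hR₀ρ)) hS
    have hb := barrier_add_le (β := β) hA x (x' - x)
    rw [add_sub_cancel] at hb
    simp only [tripled, coupling] at hm
    rw [norm_sq_sub_eq_expand (y₁ - h) x x', norm_sq_sub_eq_expand (y₂ - k) x x',
      sq_sub_eq_expand (s₁ - τ) t t', sq_sub_eq_expand (s₂ - τ) t t'] at hm
    simp only [quadTest]
    rw [inner_sub_left, real_inner_smul_left, inner_add_left, real_inner_smul_left,
      real_inner_smul_left]
    have h3 : 0 ≤ A * β ^ 2 * (t' - t) ^ 2 := by positivity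
    have h4 : 0 ≤ S * exp (ρ * t) * ρ ^ 2 * ‖x' - x‖ ^ 2 := by positivity
    linarith
  · intro s' y' _ hss
    have hm := hmax t x s' y' s₂ y₂ ht' ⟨by linarith [(abs_le.1 hss).1], ‹s' ∈ Ioc 0 T›.2⟩ hs₂'
    simp only [tripled, coupling] at hm
    rw [norm_sq_sub_sub_eq_expand h x y₁ y',
      show (s' - τ - t) ^ 2 = (s₁ - τ - t) ^ 2 + 2 * (s₁ - τ - t) * (s' - s₁) + (s' - s₁) ^ 2 by
        ring] at hm
    simp only [quadTest]
    rw [inner_neg_left, real_inner_smul_left]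
    refine le_of_mul_le_mul_left ?_ hθ
    linarith
  · intro s' y' _ hss
    have hm := hmax t x s₁ y₁ s' y' ht' hs₁' ⟨by linarith [(abs_le.1 hss).1], ‹s' ∈ Ioc 0 T›.2⟩
    simp only [tripled, coupling] at hm
    rw [norm_sq_sub_sub_eq_expand k x y₂ y',
      show (s' - τ - t) ^ 2 = (s₂ - τ - t) ^ 2 + 2 * (s₂ - τ - t) * (s' - s₂) + (s' - s₂) ^ 2 by
        ring] at hm
    simp only [quadTest]
    rw [inner_neg_left, real_inner_smul_left]
    refine le_of_mul_le_mul_left ?_ hθ1'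
    linarith
  · intro y
    -- A common shift of the three points leaves the coupling unchanged, so only the barrier limits
    -- the combination of u.
    have hm : ∀ z : Rn n, u t (x + z) - θ * u s₁ (y₁ + z) - (1 - θ) * u s₂ (y₂ + z)
        - barrier A β (x + z) ≤ u t x - θ * u s₁ y₁ - (1 - θ) * u s₂ y₂ - barrier A β x := by
      intro z
      have hm := hmax t (x + z) s₁ (y₁ + z) s₂ (y₂ + z) ht' hs₁' hs₂'
      simp only [tripled, coupling] at hm
      rw [show y₁ + z - h - (x + z) = y₁ - h - x by abel,
        show y₂ + z - k - (x + z) = y₂ - k - x by abel] at hm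
      linarith
    have h1 := hm y
    have h2 := hm (-y)
    simp only [← sub_eq_add_neg] at h2
    have h3 := secondDiff_barrier_le (β := β) hA x y
    refine le_trans ?_ h3
    unfold secondDiff
    linarith

end IsObstacleSolution

section Maximum
variable {n : ℕ} {T : ℝ} {u : ℝ → Rn n → ℝ} {θ τ : ℝ} {h k : Rn n} {S ρ β L M : ℝ}

lemma coupling_nonneg (hθ : 0 ≤ θ) (hθ1 : θ ≤ 1) (t : ℝ) (x : Rn n) (s₁ : ℝ) (y₁ : Rn n) (s₂ : ℝ)
    (y₂ : Rn n) : 0 ≤ coupling θ τ h k t x s₁ y₁ s₂ y₂ :=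
  add_nonneg (mul_nonneg hθ (by positivity)) (mul_nonneg (sub_nonneg.2 hθ1) (by positivity))

lemma combination_le_two_mul (hθ : 0 ≤ θ) (hθ1 : θ ≤ 1) {α γ δ : ℝ} (hα : |α| ≤ M) (hγ : |γ| ≤ M)
    (hδ : |δ| ≤ M) : α - θ * γ - (1 - θ) * δ ≤ 2 * M := by
  have h1 := mul_le_mul_of_nonneg_left (abs_le.1 hγ).1 hθ
  have h2 := mul_le_mul_of_nonneg_left (abs_le.1 hδ).1 (sub_nonneg.2 hθ1)
  linarith [(abs_le.1 hα).2]

/-- The tripled functional attains its maximum in a compact set that does not depend on the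
strength `L` of the coupling. -/
lemma exists_max_tripled (hu : ContinuousOn (fun p : ℝ × Rn n => u p.1 p.2) (Icc 0 T ×ˢ univ))
    (hM0 : 0 ≤ M) (hM : ∀ t ∈ Icc 0 T, ∀ x, |u t x| ≤ M) (hθ : 0 < θ) (hθ1 : θ < 1)
    (hτ : 0 ≤ τ) (hS : 0 ≤ S) (hβ : 0 < β) :
    ∃ K : Set (ℝ × Rn n × ℝ × Rn n × ℝ × Rn n), IsCompact K ∧
      (∀ t x s₁ y₁ s₂ y₂, (t, x, s₁, y₁, s₂, y₂) ∈ K →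
        t ∈ Icc 0 T ∧ s₁ ∈ Icc τ T ∧ s₂ ∈ Icc τ T) ∧
      ∀ L : ℝ, 1 ≤ L → ∀ t' x' s₁' y₁' s₂' y₂', t' ∈ Icc 0 T → s₁' ∈ Icc τ T → s₂' ∈ Icc τ T →
        0 < tripled u θ τ h k S ρ (4 * M) β L t' x' s₁' y₁' s₂' y₂' →
        ∃ t x s₁ y₁ s₂ y₂, (t, x, s₁, y₁, s₂, y₂) ∈ K ∧
          ∀ t' x' s₁' y₁' s₂' y₂', t' ∈ Icc 0 T → s₁' ∈ Icc τ T → s₂' ∈ Icc τ T →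
            tripled u θ τ h k S ρ (4 * M) β L t' x' s₁' y₁' s₂' y₂' ≤
              tripled u θ τ h k S ρ (4 * M) β L t x s₁ y₁ s₂ y₂ := by
  have hθ1' : 0 < 1 - θ := by linarith
  -- Q is the separation at which either half of the coupling alone reaches 2M, the largest possible
  -- value of the combination of u.
  obtain ⟨Q, hQ0, hQ1, hQ2⟩ : ∃ Q : ℝ, 0 ≤ Q ∧ 2 * M ≤ θ * Q ^ 2 ∧ 2 * M ≤ (1 - θ) * Q ^ 2 := by
    have hm : 0 < min θ (1 - θ) := lt_min hθ hθ1'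
    have hsq : √(2 * M / min θ (1 - θ)) ^ 2 = 2 * M / min θ (1 - θ) :=
      Real.sq_sqrt (by positivity)
    refine ⟨√(2 * M / min θ (1 - θ)), Real.sqrt_nonneg _, ?_, ?_⟩ <;> rw [hsq]
    · calc 2 * M = min θ (1 - θ) * (2 * M / min θ (1 - θ)) := by field_simp
        _ ≤ _ := by gcongr; exact min_le_left _ _
    · calc 2 * M = min θ (1 - θ) * (2 * M / min θ (1 - θ)) := by field_simp
        _ ≤ _ := by gcongr; exact min_le_right _ _
  set K : Set (ℝ × Rn n × ℝ × Rn n × ℝ × Rn n) := Icc 0 T ×ˢ Metric.closedBall 0 β⁻¹ ×ˢ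
    Icc τ T ×ˢ Metric.closedBall 0 (β⁻¹ + ‖h‖ + Q) ×ˢ Icc τ T ×ˢ
    Metric.closedBall 0 (β⁻¹ + ‖k‖ + Q) with hK
  have hKc : IsCompact K :=
    isCompact_Icc.prod ((isCompact_closedBall _ _).prod (isCompact_Icc.prod
      ((isCompact_closedBall _ _).prod (isCompact_Icc.prod (isCompact_closedBall _ _)))))
  have hKmem : ∀ t x s₁ y₁ s₂ y₂, (t, x, s₁, y₁, s₂, y₂) ∈ K →
        t ∈ Icc 0 T ∧ s₁ ∈ Icc τ T ∧ s₂ ∈ Icc τ T := by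
    rintro t x s₁ y₁ s₂ y₂ ⟨h1, _, h2, _, h3, _⟩
    exact ⟨h1, h2, h3⟩
  have hτI : ∀ {s'}, s' ∈ Icc τ T → s' ∈ Icc 0 T := fun hs => ⟨hτ.trans hs.1, hs.2⟩
  refine ⟨K, hKc, hKmem, fun L hL t' x' s₁' y₁' s₂' y₂' ht' hs₁' hs₂' hpos => ?_⟩
  -- The functional is nonpositive outside `K`: for ‖x‖ > 1/β the barrier of height 4M is already at
  -- least 2M, and distant y₁ or y₂ make the coupling too large. Since L ≥ 1, one compact set serves
  -- every L.
  have hout : ∀ t x s₁ y₁ s₂ y₂, t ∈ Icc 0 T → s₁ ∈ Icc τ T → s₂ ∈ Icc τ T →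
      0 < tripled u θ τ h k S ρ (4 * M) β L t x s₁ y₁ s₂ y₂ → (t, x, s₁, y₁, s₂, y₂) ∈ K := by
    intro t x s₁ y₁ s₂ y₂ ht hs₁ hs₂ hp
    have hW := combination_le_two_mul hθ.le hθ1.le (hM t ht x) (hM s₁ (hτI hs₁) y₁)
      (hM s₂ (hτI hs₂) y₂)
    have hc := coupling_nonneg (τ := τ) (h := h) (k := k) hθ.le hθ1.le t x s₁ y₁ s₂ y₂
    have hLc := mul_le_mul_of_nonneg_right hL hc
    have hq := barrier_nonneg (β := β) (mul_nonneg zero_le_four hM0) x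
    have hg : 0 ≤ S * exp (ρ * t) := by positivity
    have hx : ‖x‖ ≤ β⁻¹ := by
      by_contra! hx
      have h1 : 1 ≤ β * ‖x‖ := by
        calc 1 = β * β⁻¹ := (mul_inv_cancel₀ hβ.ne').symm
          _ ≤ β * ‖x‖ := by gcongr
      have h2 := half_le_barrier (β := β) (mul_nonneg zero_le_four hM0) (x := x)
        (by nlinarith)
      unfold tripled at hp
      linarith
    have hc2 : coupling θ τ h k t x s₁ y₁ s₂ y₂ < 2 * M := by
      unfold tripled at hp
      linarith
    have far : ∀ {y c : Rn n}, ‖y - c - x‖ ≤ Q → ‖y‖ ≤ β⁻¹ + ‖c‖ + Q := by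
      intro y c hy
      calc ‖y‖ = ‖x + c + (y - c - x)‖ := by congr 1; abel
        _ ≤ ‖x‖ + ‖c‖ + ‖y - c - x‖ := norm_add₃_le
        _ ≤ _ := by gcongr
    have h1 : ‖y₁ - h - x‖ ≤ Q := by
      by_contra! hlt
      have e1 : θ * Q ^ 2 ≤ θ * ‖y₁ - h - x‖ ^ 2 := by gcongr
      have e2 := mul_nonneg hθ.le (sq_nonneg (s₁ - τ - t))
      have e3 : 0 ≤ (1 - θ) * ((s₂ - τ - t) ^ 2 + ‖y₂ - k - x‖ ^ 2) := by positivity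
      unfold coupling at hc2
      linarith
    have h2 : ‖y₂ - k - x‖ ≤ Q := by
      by_contra! hlt
      have e1 : (1 - θ) * Q ^ 2 ≤ (1 - θ) * ‖y₂ - k - x‖ ^ 2 := by gcongr
      have e2 := mul_nonneg hθ1'.le (sq_nonneg (s₂ - τ - t))
      have e3 : 0 ≤ θ * ((s₁ - τ - t) ^ 2 + ‖y₁ - h - x‖ ^ 2) := by positivity
      unfold coupling at hc2
      linarith
    exact ⟨ht, mem_closedBall_zero_iff.2 hx, hs₁, mem_closedBall_zero_iff.2 (far h1), hs₂,
      mem_closedBall_zero_iff.2 (far h2)⟩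
  have hcont : ContinuousOn (fun P : ℝ × Rn n × ℝ × Rn n × ℝ × Rn n =>
      tripled u θ τ h k S ρ (4 * M) β L P.1 P.2.1 P.2.2.1 P.2.2.2.1 P.2.2.2.2.1 P.2.2.2.2.2) K := by
    have c0 : ContinuousOn (fun P : ℝ × Rn n × ℝ × Rn n × ℝ × Rn n => u P.1 P.2.1) K :=
      hu.comp (f := fun P : ℝ × Rn n × ℝ × Rn n × ℝ × Rn n => (P.1, P.2.1)) (by fun_prop)
        fun P hP => ⟨hP.1, mem_univ _⟩
    have c1 : ContinuousOn (fun P : ℝ × Rn n × ℝ × Rn n × ℝ × Rn n => u P.2.2.1 P.2.2.2.1) K :=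
      hu.comp (f := fun P : ℝ × Rn n × ℝ × Rn n × ℝ × Rn n => (P.2.2.1, P.2.2.2.1)) (by fun_prop)
        fun P hP => ⟨hτI hP.2.2.1, mem_univ _⟩
    have c2 : ContinuousOn
        (fun P : ℝ × Rn n × ℝ × Rn n × ℝ × Rn n => u P.2.2.2.2.1 P.2.2.2.2.2) K :=
      hu.comp (f := fun P : ℝ × Rn n × ℝ × Rn n × ℝ × Rn n => (P.2.2.2.2.1, P.2.2.2.2.2))
        (by fun_prop) fun P hP => ⟨hτI hP.2.2.2.2.1, mem_univ _⟩
    have c3 : Continuous (fun P : ℝ × Rn n × ℝ × Rn n × ℝ × Rn n => barrier (4 * M) β P.2.1) :=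
      continuous_barrier.comp (by fun_prop)
    have c4 : Continuous (fun P : ℝ × Rn n × ℝ × Rn n × ℝ × Rn n => S * exp (ρ * P.1)) := by
      fun_prop
    have c5 : Continuous (fun P : ℝ × Rn n × ℝ × Rn n × ℝ × Rn n => L * coupling θ τ h k
        P.1 P.2.1 P.2.2.1 P.2.2.2.1 P.2.2.2.2.1 P.2.2.2.2.2) := by
      unfold coupling
      fun_prop
    exact ((((c0.sub (c1.const_smul θ)).sub (c2.const_smul (1 - θ))).sub c4.continuousOn).sub
      c3.continuousOn).sub c5.continuousOn
  obtain ⟨⟨t, x, s₁, y₁, s₂, y₂⟩, hP, hPmax⟩ :=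
    hKc.exists_isMaxOn ⟨_, hout _ _ _ _ _ _ ht' hs₁' hs₂' hpos⟩ hcont
  refine ⟨t, x, s₁, y₁, s₂, y₂, hP, fun a z d e f g ha hd hf => ?_⟩
  have hpos' := hpos.trans_le (hPmax (hout _ _ _ _ _ _ ht' hs₁' hs₂' hpos))
  by_cases h0 : 0 < tripled u θ τ h k S ρ (4 * M) β L a z d e f g
  · exact hPmax (hout _ _ _ _ _ _ ha hd hf h0)
  · exact (not_lt.1 h0).trans hpos'.le

lemma eq_of_coupling_eq_zero (hθ : 0 < θ) (hθ1 : θ < 1) {t : ℝ} {x : Rn n} {s₁ : ℝ} {y₁ : Rn n}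
    {s₂ : ℝ} {y₂ : Rn n} (h0 : coupling θ τ h k t x s₁ y₁ s₂ y₂ = 0) :
    s₁ = t + τ ∧ y₁ = x + h ∧ s₂ = t + τ ∧ y₂ = x + k := by
  have hθ1' : 0 < 1 - θ := by linarith
  have a1 : 0 ≤ θ * (s₁ - τ - t) ^ 2 := by positivity
  have a2 : 0 ≤ θ * ‖y₁ - h - x‖ ^ 2 := by positivity
  have a3 : 0 ≤ (1 - θ) * (s₂ - τ - t) ^ 2 := by positivity
  have a4 : 0 ≤ (1 - θ) * ‖y₂ - k - x‖ ^ 2 := by positivity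
  unfold coupling at h0
  have z1 : θ * (s₁ - τ - t) ^ 2 = 0 := by linarith
  have z2 : θ * ‖y₁ - h - x‖ ^ 2 = 0 := by linarith
  have z3 : (1 - θ) * (s₂ - τ - t) ^ 2 = 0 := by linarith
  have z4 : (1 - θ) * ‖y₂ - k - x‖ ^ 2 = 0 := by linarith
  simp only [mul_eq_zero, hθ.ne', hθ1'.ne', false_or, pow_eq_zero_iff, ne_eq,
    OfNat.ofNat_ne_zero, not_false_eq_true, norm_eq_zero, sub_eq_zero] at z1 z2 z3 z4
  exact ⟨by linarith, by rw [← z2]; abel, by linarith, by rw [← z4]; abel⟩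

end Maximum

/-! ### The comparison principle -/

namespace IsObstacleSolution
variable {n : ℕ} {T s : ℝ} {b : Rn n} {r : ℝ} {J : (Rn n → ℝ) → Rn n → ℝ} {ψ : Rn n → ℝ}
  {u : ℝ → Rn n → ℝ}

lemma tendsto_value (hu : IsObstacleSolution T s b r J ψ u) {t : ℕ → ℝ} {x : ℕ → Rn n} {t' : ℝ}
    {x' : Rn n} (ht : ∀ j, t j ∈ Icc 0 T) (ht' : t' ∈ Icc 0 T) (h1 : Tendsto t atTop (𝓝 t'))
    (h2 : Tendsto x atTop (𝓝 x')) : Tendsto (fun j => u (t j) (x j)) atTop (𝓝 (u t' x')) :=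
  (hu.continuous (t', x') ⟨ht', mem_univ _⟩).tendsto.comp
    (tendsto_nhdsWithin_iff.2 ⟨h1.prodMk_nhds h2, Eventually.of_forall fun j => ⟨ht j, mem_univ _⟩⟩)

/-- Comparison of the solution with a convex combination of its space-time translates. -/
theorem le_combination_translates (hn : 1 ≤ n) {σ lam Lam : ℝ} (hs0 : 0 < s) (hs1 : s < 1)
    (hσ : 0 < σ) (hσ1 : σ < 1) (hlam : 0 ≤ lam) (hLam : lam ≤ Lam)
    (hJ : IsConvexEllipticOperator σ lam Lam J) (hψ : Continuous ψ)
    (hu : IsObstacleSolution T s b r J ψ u) {θ τ : ℝ} (hθ : 0 < θ) (hθ1 : θ < 1) (hτ : 0 ≤ τ)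
    {h k : Rn n} {c : ℝ} (hc : 0 ≤ c)
    (hψc : ∀ x, ψ x ≤ θ * ψ (x + h) + (1 - θ) * ψ (x + k) + c) {t : ℝ} (ht : t ∈ Icc 0 (T - τ))
    (x : Rn n) :
    u t x ≤ θ * u (t + τ) (x + h) + (1 - θ) * u (t + τ) (x + k) + c * exp ((max r 0 + 1) * t) := by
  obtain ⟨M₀, hM₀⟩ := hu.sub.bounded
  set M := max M₀ 0
  have hM0 : 0 ≤ M := le_max_right _ _
  have hM : ∀ t ∈ Icc 0 T, ∀ x, |u t x| ≤ M := fun t ht x => (hM₀ t ht x).trans (le_max_left _ _)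
  set ρ := max r 0 + 1 with hρdef
  have hr0 : 0 ≤ max r 0 := le_max_right _ _
  have hρ : 0 < ρ := by linarith
  have hθ1' : 0 < 1 - θ := by linarith
  set D : ℝ → Rn n → ℝ := fun t x =>
    u t x - θ * u (t + τ) (x + h) - (1 - θ) * u (t + τ) (x + k) with hD
  have mem0 : ∀ {t}, t ∈ Icc 0 (T - τ) → t ∈ Icc 0 T := fun ht => ⟨ht.1, by linarith [ht.2]⟩
  have memτ : ∀ {t}, t ∈ Icc 0 (T - τ) → t + τ ∈ Icc τ T := fun ht =>
    ⟨by linarith [ht.1], by linarith [ht.2]⟩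
  have memτ0 : ∀ {t}, t ∈ Icc τ T → t ∈ Icc 0 T := fun ht => ⟨by linarith [ht.1], ht.2⟩
  by_contra! hcon
  -- The supremum S of this set is the least constant with D ≤ S·exp(ρt); the failure of the claim
  -- means S > c.
  set E : Set ℝ := {v | ∃ t ∈ Icc 0 (T - τ), ∃ x, v = exp (-(ρ * t)) * D t x} with hE
  have hEbdd : BddAbove E := by
    refine ⟨2 * M, ?_⟩
    rintro v ⟨t, ht, x, rfl⟩
    have hW : D t x ≤ 2 * M := combination_le_two_mul hθ.le hθ1.le (hM _ (mem0 ht) _)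
      (hM _ (memτ0 (memτ ht)) _) (hM _ (memτ0 (memτ ht)) _)
    have he : exp (-(ρ * t)) ≤ 1 := Real.exp_le_one_iff.2 (by nlinarith [ht.1])
    have he0 := (Real.exp_pos (-(ρ * t))).le
    calc exp (-(ρ * t)) * D t x ≤ exp (-(ρ * t)) * (2 * M) := by gcongr
      _ ≤ 2 * M := mul_le_of_le_one_left (by positivity) he
  have hmul : ∀ (t d : ℝ), exp (ρ * t) * (exp (-(ρ * t)) * d) = d := fun t d => by
    rw [← mul_assoc, ← Real.exp_add]; simp
  set S := sSup E with hSdef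
  have hDS : ∀ t ∈ Icc 0 (T - τ), ∀ x, D t x ≤ S * exp (ρ * t) := by
    intro t ht x
    have h1 : exp (-(ρ * t)) * D t x ≤ S := le_csSup hEbdd ⟨t, ht, x, rfl⟩
    have h2 := mul_le_mul_of_nonneg_left h1 (Real.exp_pos (ρ * t)).le
    rw [hmul] at h2
    linarith
  have hcS : c < S := by
    refine lt_of_lt_of_le ?_ (le_csSup hEbdd ⟨t, ht, x, rfl⟩)
    rw [Real.exp_neg, ← div_eq_inv_mul, lt_div_iff₀ (Real.exp_pos _)]
    simp only [hD]
    linarith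
  have hS0 : 0 < S := hc.trans_lt hcS
  -- A level S' strictly between S₁ and a value attained in `E` exceeds c, which keeps the argument
  -- off the obstacle, and satisfies ρS' > max(r,0)·S, which is the final contradiction. Such levels
  -- exist because ρ > max(r,0).
  set S₁ := max c (max r 0 * S / ρ)
  have hS₁ : S₁ < S := max_lt hcS (by rw [div_lt_iff₀ hρ, hρdef]; linarith)
  obtain ⟨_, ⟨ts, hts, xs, rfl⟩, hlt⟩ := exists_lt_of_lt_csSup (s := E) ⟨_, t, ht, x, rfl⟩ hS₁
  obtain ⟨S', hS'1, hS'2⟩ := exists_between hlt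
  have hcS' : c < S' := (le_max_left _ _).trans_lt hS'1
  have hS'0 : 0 ≤ S' := hc.trans hcS'.le
  have hgap : 0 < ρ * S' - max r 0 * S := by
    have := (le_max_right _ _).trans_lt hS'1
    rw [div_lt_iff₀ hρ] at this
    linarith
  have hDs : S' * exp (ρ * ts) < D ts xs := by
    have h2 := mul_lt_mul_of_pos_left hS'2 (Real.exp_pos (ρ * ts))
    rw [hmul] at h2
    linarith
  -- The scale β is fixed before the coupling strength grows: the barrier must not destroy
  -- positivity at (ts, xs), and its total error must stay below the gap.
  obtain ⟨β, hβ, hβ1, hβs, hβe⟩ : ∃ β : ℝ, 0 < β ∧ β ≤ 1 ∧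
      barrier (4 * M) β xs < D ts xs - S' * exp (ρ * ts) ∧
      4 * M * β * ‖b‖ + 2 * (4 * M) * (fracConst n s / 2 * tailError n s β
        + Lam * tailError n σ β) < ρ * S' - max r 0 * S := by
    have l1 : Tendsto (fun β : ℝ => 4 * M * β * ‖b‖ + 2 * (4 * M) * (fracConst n s / 2 *
        tailError n s β + Lam * tailError n σ β)) (𝓝[>] 0)
        (𝓝 (4 * M * 0 * ‖b‖ + 2 * (4 * M) * (fracConst n s / 2 * 0 + Lam * 0))) := by
      refine Tendsto.add ?_ ((((tendsto_tailError hn hs0 hs1).const_mul _).add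
        ((tendsto_tailError hn hσ hσ1).const_mul _)).const_mul _)
      exact ((tendsto_id.mono_left nhdsWithin_le_nhds).const_mul _).mul_const _
    simp only [mul_zero, zero_mul, add_zero] at l1
    have l0 : ∀ᶠ β in 𝓝[>] (0 : ℝ), β ∈ Ioo (0 : ℝ) 1 := Ioo_mem_nhdsGT zero_lt_one
    obtain ⟨β, hβ, h1, h2⟩ := (l0.and (((tendsto_barrier (A := 4 * M) xs).eventually_lt_const
        (sub_pos.2 hDs)).and (l1.eventually_lt_const hgap))).exists
    exact ⟨β, hβ.1, hβ.2.le, h1, h2⟩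
  set m₀ := D ts xs - S' * exp (ρ * ts) - barrier (4 * M) β xs with hm₀
  have hm₀pos : 0 < m₀ := by linarith
  have hdiag : ∀ L : ℝ, tripled u θ τ h k S' ρ (4 * M) β L ts xs (ts + τ) (xs + h) (ts + τ)
      (xs + k) = m₀ := by
    intro L
    simp [tripled, coupling, hm₀, hD]
  obtain ⟨K, hKc, hKmem, hKmax⟩ := exists_max_tripled (h := h) (k := k) (ρ := ρ) hu.continuous hM0
    hM hθ hθ1 hτ hS'0 hβ
  have hmaxj : ∀ j : ℕ, _ := fun j => hKmax ((j : ℝ) + 1) (by linarith [j.cast_nonneg (α := ℝ)])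
    ts xs (ts + τ) (xs + h) (ts + τ) (xs + k) (mem0 hts) (memτ hts) (memτ hts)
    (by rw [hdiag]; exact hm₀pos)
  choose t x s₁ y₁ s₂ y₂ hPK hPmax using hmaxj
  have htj : ∀ j, t j ∈ Icc 0 T := fun j => (hKmem _ _ _ _ _ _ (hPK j)).1
  have hs₁j : ∀ j, s₁ j ∈ Icc τ T := fun j => (hKmem _ _ _ _ _ _ (hPK j)).2.1
  have hs₂j : ∀ j, s₂ j ∈ Icc τ T := fun j => (hKmem _ _ _ _ _ _ (hPK j)).2.2
  have hlow : ∀ j : ℕ, m₀ + ((j : ℝ) + 1) * coupling θ τ h k (t j) (x j) (s₁ j) (y₁ j) (s₂ j) (y₂ j)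
      + S' * exp (ρ * t j) ≤
      u (t j) (x j) - θ * u (s₁ j) (y₁ j) - (1 - θ) * u (s₂ j) (y₂ j) := by
    intro j
    have h1 := hPmax j ts xs (ts + τ) (xs + h) (ts + τ) (xs + k) (mem0 hts) (memτ hts) (memτ hts)
    rw [hdiag] at h1
    have h2 := barrier_nonneg (β := β) (mul_nonneg zero_le_four hM0) (x j)
    unfold tripled at h1
    linarith
  have hcoup : ∀ j : ℕ, coupling θ τ h k (t j) (x j) (s₁ j) (y₁ j) (s₂ j) (y₂ j) ≤
      2 * M * (1 / ((j : ℝ) + 1)) := by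
    intro j
    have h1 := combination_le_two_mul hθ.le hθ1.le (hM _ (htj j) (x j))
      (hM _ (memτ0 (hs₁j j)) (y₁ j)) (hM _ (memτ0 (hs₂j j)) (y₂ j))
    have h2 := hlow j
    have h3 : 0 ≤ S' * exp (ρ * t j) := by positivity
    rw [mul_one_div, le_div_iff₀ (by positivity)]
    linarith
  -- As the strength j + 1 tends to infinity the coupling tends to 0, so a subsequence of maxima
  -- converges to a configuration with exact shifts.
  obtain ⟨⟨t', x', s₁', y₁', s₂', y₂'⟩, hP', φ, hφ, hlim⟩ := hKc.tendsto_subseq hPK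
  rw [nhds_prod_eq, nhds_prod_eq, nhds_prod_eq, nhds_prod_eq, nhds_prod_eq] at hlim
  simp only [tendsto_prod_iff'] at hlim
  obtain ⟨lt, lx, ls₁, ly₁, ls₂, ly₂⟩ := hlim
  simp only [Function.comp_def] at lt lx ls₁ ly₁ ls₂ ly₂
  have hcz : coupling θ τ h k t' x' s₁' y₁' s₂' y₂' = 0 := by
    refine le_antisymm ?_ (coupling_nonneg hθ.le hθ1.le _ _ _ _ _ _)
    have l1 : Tendsto (fun j => coupling θ τ h k (t (φ j)) (x (φ j)) (s₁ (φ j)) (y₁ (φ j))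
        (s₂ (φ j)) (y₂ (φ j))) atTop (𝓝 (coupling θ τ h k t' x' s₁' y₁' s₂' y₂')) := by
      unfold coupling
      exact ((((((ls₁.sub_const τ).sub lt).pow 2).add (((ly₁.sub_const h).sub lx).norm.pow 2)
        ).const_mul θ).add (((((ls₂.sub_const τ).sub lt).pow 2).add
          (((ly₂.sub_const k).sub lx).norm.pow 2)).const_mul (1 - θ)))
    have l2 := (tendsto_one_div_add_atTop_nhds_zero_nat (𝕜 := ℝ)).const_mul (2 * M)
    rw [mul_zero] at l2
    exact le_of_tendsto_of_tendsto' l1 (l2.comp hφ.tendsto_atTop) fun j => hcoup (φ j)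
  obtain ⟨rfl, rfl, rfl, rfl⟩ := eq_of_coupling_eq_zero hθ hθ1 hcz
  obtain ⟨ht'T, hs'T, -⟩ := hKmem _ _ _ _ _ _ hP'
  have ht'I : t' ∈ Icc 0 (T - τ) := ⟨ht'T.1, by linarith [hs'T.2]⟩
  have lu₀ := hu.tendsto_value (fun j => htj (φ j)) ht'T lt lx
  have lu₁ := hu.tendsto_value (fun j => memτ0 (hs₁j (φ j))) (memτ0 hs'T) ls₁ ly₁
  have lu₂ := hu.tendsto_value (fun j => memτ0 (hs₂j (φ j))) (memτ0 hs'T) ls₂ ly₂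
  have lD : Tendsto (fun j => u (t (φ j)) (x (φ j)) - θ * u (s₁ (φ j)) (y₁ (φ j))
      - (1 - θ) * u (s₂ (φ j)) (y₂ (φ j))) atTop (𝓝 (D t' x')) :=
    (lu₀.sub (lu₁.const_mul θ)).sub (lu₂.const_mul (1 - θ))
  have lexp : Tendsto (fun j => exp (ρ * t (φ j))) atTop (𝓝 (exp (ρ * t'))) :=
    (lt.const_mul ρ).rexp
  have hexp1 : 1 ≤ exp (ρ * t') := Real.one_le_exp (mul_nonneg hρ.le ht'T.1)
  have hDlow : S' * exp (ρ * t') < D t' x' := by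
    have := le_of_tendsto_of_tendsto' ((lexp.const_mul S').const_add m₀) lD fun j => by
      have h1 := hlow (φ j)
      have h2 := mul_nonneg (by positivity : 0 ≤ ((φ j : ℕ) : ℝ) + 1)
        (coupling_nonneg (τ := τ) (h := h) (k := k) hθ.le hθ1.le (t (φ j)) (x (φ j)) (s₁ (φ j))
          (y₁ (φ j)) (s₂ (φ j)) (y₂ (φ j)))
      linarith
    linarith
  have hS'D : S' < D t' x' := lt_of_le_of_lt (le_mul_of_one_le_right hS'0 hexp1) hDlow
  have hobs : θ * ψ (x' + h) + (1 - θ) * ψ (x' + k) ≤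
      θ * u (t' + τ) (x' + h) + (1 - θ) * u (t' + τ) (x' + k) := by
    gcongr <;> exact hu.obstacle_le (memτ0 hs'T) _
  -- The excess at the limit is larger than c, whereas the obstacle's own excess is at most c and
  -- the translates of u dominate those of ψ.
  have hψu : ψ x' < u t' x' := by
    have := hψc x'
    simp only [hD] at hS'D
    linarith
  have ht'0 : 0 < t' := by
    refine lt_of_le_of_ne ht'T.1 fun h0 => ?_
    have := hu.sub.initial x'
    rw [← h0] at hψu
    linarith
  have hev : ∀ᶠ j in atTop, S' * ρ * exp (ρ * t (φ j)) - r * (u (t (φ j)) (x (φ j))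
      - θ * u (s₁ (φ j)) (y₁ (φ j)) - (1 - θ) * u (s₂ (φ j)) (y₂ (φ j))) ≤
      4 * M * β * ‖b‖ + 2 * (4 * M) * (fracConst n s / 2 * tailError n s β
        + Lam * tailError n σ β) := by
    -- Strict positivity of the times and noncontact at the limit pass to the maxima far along the
    -- subsequence, so the equations hold there.
    filter_upwards [lt.eventually_const_lt ht'0, ls₁.eventually_const_lt (by linarith : τ < t' + τ),
      ls₂.eventually_const_lt (by linarith : τ < t' + τ),
      ((hψ.tendsto x').comp lx).eventually_lt lu₀ hψu] with j h1 h2 h3 h4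
    exact hu.inequality_at_max hn hs0 hs1 hσ hσ1 hlam hLam hJ hθ hθ1 hτ hS'0 hρ
      (mul_nonneg zero_le_four hM0) hβ hβ1 (by positivity) ⟨h1, (htj _).2⟩ ⟨h2, (hs₁j _).2⟩
      ⟨h3, (hs₂j _).2⟩ h4 (hPmax (φ j))
  have hfin := le_of_tendsto ((lexp.const_mul (S' * ρ)).sub (lD.const_mul r)) hev
  -- The zeroth-order term is controlled by the supremum S rather than S', hence the need for S'
  -- close to S.
  have h1 : r * D t' x' ≤ max r 0 * (S * exp (ρ * t')) :=
    mul_le_mul (le_max_left _ _) (hDS t' ht'I x') (hS'0.trans hS'D.le) hr0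
  have h2 : ρ * S' - max r 0 * S ≤ (ρ * S' - max r 0 * S) * exp (ρ * t') :=
    le_mul_of_one_le_right hgap.le hexp1
  linarith

end IsObstacleSolution

/-! ### Bounds on the obstacle and the conclusions -/

namespace IsObstacle
variable {n : ℕ} {ψ : Rn n → ℝ}

/-- Mean value inequalities for ψ and its derivative. The Taylor remainder uses the oscillation of
the derivative over the ball of radius ‖h‖, which gives M where M/2 would be sharp. -/
lemma exists_bounds (hψ : IsObstacle ψ) : ∃ M : ℝ, 0 ≤ M ∧ (∀ x y, ψ x ≤ ψ y + M * ‖y - x‖) ∧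
    ∀ x h, ψ x + fderiv ℝ ψ x h - M * ‖h‖ ^ 2 ≤ ψ (x + h) := by
  obtain ⟨M, hM⟩ := hψ.bounded
  have hd : Differentiable ℝ ψ := hψ.contDiff.differentiable (by norm_num)
  have hdd : Differentiable ℝ (fderiv ℝ ψ) :=
    (hψ.contDiff.fderiv_right (m := 1) (by norm_num)).differentiable (by norm_num)
  have h2 : ∀ x, ‖fderiv ℝ (fderiv ℝ ψ) x‖ ≤ M := fun x => by
    rw [← norm_iteratedFDeriv_one, norm_iteratedFDeriv_fderiv]
    exact (hM x).2.2
  have hM0 : 0 ≤ M := (norm_nonneg _).trans (hM 0).2.1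
  refine ⟨M, hM0, fun x y => ?_, fun x h => ?_⟩
  · have := convex_univ.norm_image_sub_le_of_norm_fderiv_le (fun z _ => hd z)
      (fun z _ => (hM z).2.1) (mem_univ y) (mem_univ x)
    rw [norm_sub_rev x y] at this
    linarith [(abs_le.1 this).2]
  · have hlip : ∀ z ∈ Metric.closedBall x ‖h‖, ‖fderiv ℝ ψ z - fderiv ℝ ψ x‖ ≤ M * ‖h‖ := by
      intro z hz
      refine (convex_univ.norm_image_sub_le_of_norm_fderiv_le (fun z _ => hdd z)
        (fun z _ => h2 z) (mem_univ x) (mem_univ z)).trans ?_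
      gcongr
      rwa [← dist_eq_norm]
    have := (convex_closedBall x ‖h‖).norm_image_sub_le_of_norm_fderiv_le' (fun z _ => hd z)
      hlip (Metric.mem_closedBall_self (norm_nonneg _)) (y := x + h) (by simp)
    rw [add_sub_cancel_left] at this
    nlinarith [(abs_le.1 this).1]

end IsObstacle

theorem lemma2p14 (n : ℕ) (hn : 2 ≤ n) (T s σ lam Lam : ℝ) (hT : 0 < T)
    (hs : 1 / 2 < s) (hs1 : s < 1) (hσ : 0 < σ) (hσs : σ < s)
    (hlam : 0 < lam) (hLam : lam ≤ Lam)
    (b : Rn n) (r : ℝ)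
    (J : (Rn n → ℝ) → Rn n → ℝ) (hJ : IsConvexEllipticOperator σ lam Lam J)
    (ψ : Rn n → ℝ) (hψ : IsObstacle ψ)
    (u : ℝ → Rn n → ℝ) (hu : IsObstacleSolution T s b r J ψ u) :
    (∃ K : NNReal, ∀ t ∈ Set.Ioc 0 T, LipschitzWith K (u t)) ∧
    (∃ C : ℝ, 0 ≤ C ∧ ∀ t ∈ Set.Ioc 0 T, IsSemiconvexWith C (u t)) ∧
    (∀ x : Rn n, MonotoneOn (fun t => u t x) (Set.Icc 0 T)) := by
  obtain ⟨M, hM0, hlip, hquad⟩ := hψ.exists_bounds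
  have cmp : ∀ {θ τ : ℝ}, 0 < θ → θ < 1 → 0 ≤ τ → ∀ {h k : Rn n} {c : ℝ}, 0 ≤ c →
      (∀ x, ψ x ≤ θ * ψ (x + h) + (1 - θ) * ψ (x + k) + c) → ∀ {t : ℝ}, t ∈ Icc 0 (T - τ) →
      ∀ x, u t x ≤ θ * u (t + τ) (x + h) + (1 - θ) * u (t + τ) (x + k)
        + c * exp ((max r 0 + 1) * t) :=
    fun hθ hθ1 hτ _ _ _ hc hψc _ ht x => hu.le_combination_translates (by omega) (by linarith) hs1
      hσ (hσs.trans hs1) hlam.le hLam hJ hψ.contDiff.continuous hθ hθ1 hτ hc hψc ht x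
  set ρ := max r 0 + 1
  have hρ : 0 ≤ ρ := by positivity
  have hexp : ∀ t ∈ Ioc 0 T, exp (ρ * t) ≤ exp (ρ * T) := fun t ht =>
    Real.exp_le_exp.2 (mul_le_mul_of_nonneg_left ht.2 hρ)
  refine ⟨⟨⟨M * exp (ρ * T), by positivity⟩, fun t ht => LipschitzWith.of_le_add_mul _ ?_⟩,
    ⟨2 * (M * exp (ρ * T)), by positivity, fun t ht => ⟨convex_univ, ?_⟩⟩, fun x t ht t' ht' htt' => ?_⟩
  · intro x y
    -- Equal shifts make the convex combination a single translate, so the value of θ is immaterial.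
    have h1 := cmp (θ := 1 / 2) (τ := 0) (by norm_num) (by norm_num) le_rfl (h := y - x)
      (k := y - x) (c := M * ‖y - x‖) (by positivity)
      (fun z => by
        have := hlip z (z + (y - x))
        rw [add_sub_cancel_left] at this
        linarith) (t := t) ⟨ht.1.le, by linarith [ht.2]⟩ x
    rw [add_zero, add_sub_cancel] at h1
    have h2 := mul_le_mul_of_nonneg_left (hexp t ht) (by positivity : 0 ≤ M * ‖y - x‖)
    rw [dist_comm, dist_eq_norm]
    change u t x ≤ u t y + M * exp (ρ * T) * ‖y - x‖
    linarith
  · intro y _ z _ α γ hα hγ hαγ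
    rcases hα.eq_or_lt with rfl | hα
    · rw [zero_add] at hαγ; subst hαγ; simp
    rcases hγ.eq_or_lt with rfl | hγ
    · rw [add_zero] at hαγ; subst hαγ; simp
    obtain rfl : γ = 1 - α := by linarith
    have e1 : y - (α • y + (1 - α) • z) = (1 - α) • (y - z) := by module
    have e2 : z - (α • y + (1 - α) • z) = -(α • (y - z)) := by module
    -- In the weighted sum of the two Taylor bounds the first-order terms cancel, and α(1-α)² +
    -- (1-α)α² = α(1-α) gives c. The identity `h3` for ‖·‖² carries the same factor, so C/2 =
    -- M·exp(ρT).
    have h1 := cmp (θ := α) (τ := 0) hα (by linarith) le_rfl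
      (h := y - (α • y + (1 - α) • z)) (k := z - (α • y + (1 - α) • z))
      (c := M * (α * (1 - α) * ‖y - z‖ ^ 2)) (by positivity)
      (fun w => by
        rw [e1, e2]
        have a1 := mul_le_mul_of_nonneg_left (hquad w ((1 - α) • (y - z))) hα.le
        have a2 := mul_le_mul_of_nonneg_left (hquad w (-(α • (y - z)))) hγ.le
        rw [map_smul, norm_smul, Real.norm_eq_abs, abs_of_pos hγ, smul_eq_mul] at a1
        rw [map_neg, map_smul, norm_neg, norm_smul, Real.norm_eq_abs, abs_of_pos hα,
          smul_eq_mul] at a2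
        linear_combination a1 + a2) (t := t) ⟨ht.1.le, by linarith [ht.2]⟩ (α • y + (1 - α) • z)
    rw [add_zero, add_sub_cancel, add_sub_cancel] at h1
    have h2 := mul_le_mul_of_nonneg_left (hexp t ht)
      (by positivity : 0 ≤ M * (α * (1 - α) * ‖y - z‖ ^ 2))
    have h3 : ‖α • y + (1 - α) • z‖ ^ 2 =
        α * ‖y‖ ^ 2 + (1 - α) * ‖z‖ ^ 2 - α * (1 - α) * ‖y - z‖ ^ 2 := by
      rw [norm_add_sq_real, norm_sub_sq_real, norm_smul, norm_smul, real_inner_smul_left,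
        real_inner_smul_right, Real.norm_eq_abs, Real.norm_eq_abs, abs_of_pos hα, abs_of_pos hγ]
      ring
    simp only [smul_eq_mul]
    rw [h3]
    linarith
  -- A pure time shift leaves the obstacle unchanged, so c = 0 and no exponential error remains.
  · have h1 := cmp (θ := 1 / 2) (τ := t' - t) (by norm_num) (by norm_num) (by linarith) (h := 0)
      (k := 0) (c := 0) le_rfl (fun z => by simp only [add_zero]; linarith) (t := t)
      ⟨ht.1, by linarith [ht'.2]⟩ x
    rw [add_sub_cancel, add_zero] at h1
    show u t x ≤ u t' x
    linarith
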